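/- Let $p$ be a prime and let $(S,\mathcal F,\mathcal L)$ be a $p$-local compact group: $S$ is a discrete $p$-toral group, $\mathcal F$ is a saturated fusion system over $S$, and $\mathcal L$ is a centric linking system associated to $\mathcal F$, with projection $\pi\colon\mathcal L\to\mathcal F$. Let $P\le S$ be an $\mathcal F$-centric subgroup that is fully normalized in $\mathcal F$. Let $P\downarrow\mathcal L$ be the undercategory of $P$ in $\mathcal L$ (objects are the morphisms $P\to Q$ of $\mathcal L$, morphisms are the commuting triangles under $P$). For subgroups $Q,R\le N_SP$ let $\mathrm{Hom}_{N_{\mathcal F}P}(Q,R)$ be the set of those $\varphi\in\mathrm{Hom}_{\mathcal F}(Q,R)$ that extend to some $\varphi'\in\mathrm{Hom}_{\mathcal F}(QP,RP)$ with $\varphi'(P)=P$. Let $N_{\mathcal L}P$ be the category whose objects are the $N_{\mathcal F}P$-centric subgroups of $N_SP$ and whose morphisms $Q\to R$ are the $\varphi\in\mathrm{Hom}_{\mathcal L}(QP,RP)$ such that $\pi(\varphi)|_Q\in\mathrm{Hom}_{N_{\mathcal F}P}(Q,R)$ and $\pi(\varphi)(P)=P$. Let $P\downarrow N_{\mathcal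 L}P$ be the undercategory of $P$ in $N_{\mathcal L}P$, and let $i\colon(P\downarrow N_{\mathcal L}P)\to(P\downarrow\mathcal L)$ be the inclusion functor. Let $P\downarrow_{\not\cong}\mathcal L$ and $P\downarrow_{\not\cong}N_{\mathcal L}P$ be the full subcategories of $P\downarrow\mathcal L$ and $P\downarrow N_{\mathcal L}P$ on the objects $P\to Q$ that are not isomorphisms in $\mathcal L$. There exist families of morphisms $\iota_A^B\colon A\to B$ of $\mathcal L$, one for each pair of $\mathcal F$-centric subgroups $A\le B$ of $S$, which lift the inclusions and satisfy $\iota_A^A=\mathrm{id}$ and $\iota_B^C\circ\iota_A^B=\iota_A^C$. There also exist families of morphisms $F_\varphi\colon N_S(P_\varphi)\to N_SP$ of $\mathcal L$, one for each object $\varphi\colon P\to Q$ of $P\downarrow\mathcal L$, where $P_\varphi=\pi(\varphi)(P)$, such that $f_\varphi=\pi(F_\varphi)$ maps $P_\varphi$ onto $P$, and $F_\varphi=\mathrm{id}$ if $P_\varphi=P$. For every choice of such families there are a functor $$r\colon (P\downarrow\mathcal L)\to(P\downarrow N_{\mathcal L}P)$$ and a natural transformation $\eta\colon i\circ r\Rightarrow\mathrm{id}$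 such that the following hold. 1. For every $\varphi\colon P\to Q$, the target of $r(\varphi)$ is $T=f_\varphi(N_S(P_\varphi)\cap Q)$, and $$r(\varphi)=\iota_P^{T}\circ F_2\circ\varphi_0,\qquad \eta(\varphi)=\iota_{N_S(P_\varphi)\cap Q}^{Q}\circ F_1^{-1}\colon T\to Q,$$ where $\varphi_0\colon P\to P_\varphi$ is the corestriction of $\varphi$ (so $\iota_{P_\varphi}^{Q}\circ\varphi_0=\varphi$), and $F_1\colon N_S(P_\varphi)\cap Q\to T$ and $F_2\colon P_\varphi\to P$ are the isomorphisms of $\mathcal L$ obtained from $F_\varphi$ by restriction and corestriction along the morphisms $\iota$. 2. $r$ is a retraction: $r\circ i=\mathrm{id}$. 3. $r$ induces a homotopy equivalence of (geometrically realized) nerves $|P\downarrow\mathcal L|\to|P\downarrow N_{\mathcal L}P|$ with homotopy inverse $|i|$. 4. If $\varphi$ is not an isomorphism in $\mathcal L$, then neither is $r(\varphi)$. The restricted functors $$r'\colon (P\downarrow_{\not\cong}\mathcal L)\to(P\downarrow_{\not\cong}N_{\mathcal L}P),\qquad i'\colon (P\downarrow_{\not\cong}N_{\mathcal L}P)\to(P\downarrow_{\not\cong}\mathcal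 L)$$ satisfy $r'\circ i'=\mathrm{id}$, the transformation $\eta$ restricts to a natural transformation $i'\circ r'\Rightarrow\mathrm{id}$, and $|r'|\colon|P\downarrow_{\not\cong}\mathcal L|\to|P\downarrow_{\not\cong}N_{\mathcal L}P|$ is a homotopy equivalence with homotopy inverse $|i'|$. -/

import Mathlib

open CategoryTheory

universe u w

/-! ### Discrete `p`-toral groups -/

/-- The group `ℤ/p^∞`, realized as the `p`-primary part of `ℚ/ℤ`. -/
abbrev PruferGroup (p : ℕ) [Fact p.Prime] : Type :=
  AddCommGroup.primaryComponent (AddCircle (1 : ℚ)) p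

/-- `H` is an extension of a finite `p`-group of order `c` by `(ℤ/p^∞)^k`. -/
def HasToralSize (p : ℕ) [Fact p.Prime] (H : Type u) [Group H] (k c : ℕ) : Prop :=
  ∃ (T : Subgroup H) (_ : T.Normal),
    Nonempty (T ≃* Multiplicative (Fin k → PruferGroup p)) ∧
    Finite (H ⧸ T) ∧ IsPGroup p (H ⧸ T) ∧ Nat.card (H ⧸ T) = c

/-- Discrete `p`-toral groups. -/
def IsDiscretePToral (p : ℕ) [Fact p.Prime] (H : Type u) [Group H] : Prop :=
  ∃ k c : ℕ, HasToralSize p H k c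

open Classical in
/-- The size `(k, c)` of a discrete `p`-toral group: `k` is its rank and `c` is the number of its
components; sizes are ordered lexicographically. -/
noncomputable def toralSize (p : ℕ) [Fact p.Prime] (H : Type u) [Group H] : ℕ ×ₗ ℕ :=
  if h : ∃ a : ℕ × ℕ, HasToralSize p H a.1 a.2 then toLex h.choose else toLex (0, 0)

/-! ### Fusion systems -/

section Basic

variable {S : Type u} [Group S]

/-- The homomorphism `c_g : P → Q`, `x ↦ g x g⁻¹`, when `g P g⁻¹ ⊆ Q`. -/
def conjHom {P Q : Subgroup S} (g : S) (h : ∀ x ∈ P, g * x * g⁻¹ ∈ Q) : P →* Q :=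
  ((MulAut.conj g).toMonoidHom.comp P.subtype).codRestrict Q (fun x => h x x.2)

/-- The image of `φ : P → Q`, as a subgroup of `S`. -/
def imageOf {P Q : Subgroup S} (φ : P →* Q) : Subgroup S := (Q.subtype.comp φ).range

/-- The image `φ(A)` of those elements of the subgroup `A` of `S` that lie in the source `P`
of `φ : P → Q`, as a subgroup of `S`. -/
def imageOn {P Q : Subgroup S} (φ : P →* Q) (A : Subgroup S) : Subgroup S :=
  (A.subgroupOf P).map (Q.subtype.comp φ)

/-- The normalizer `N_S P`. -/
abbrev normS (P : Subgroup S) : Subgroup S := Subgroup.normalizer (P : Set S)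

/-- The centralizer `C_S P`. -/
abbrev centS (P : Subgroup S) : Subgroup S := Subgroup.centralizer (P : Set S)

theorem le_normS (P : Subgroup S) : P ≤ normS P := Subgroup.le_normalizer

/-- `Aut_S(P)`: the automorphisms of `P` given by conjugation by elements of `N_S P`. -/
def autS (P : Subgroup S) : Subgroup (MulAut P) where
  carrier := {α | ∃ g ∈ normS P, ∀ x : P, ((α x : P) : S) = g * x * g⁻¹}
  one_mem' := ⟨1, one_mem _, fun x => by simp⟩
  mul_mem' := by
    rintro α β ⟨g, hg, hα⟩ ⟨h, hh, hβ⟩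
    exact ⟨g * h, mul_mem hg hh, fun x => by simp [hα, hβ, mul_assoc]⟩
  inv_mem' := by
    rintro α ⟨g, hg, hα⟩
    refine ⟨g⁻¹, inv_mem hg, fun x => ?_⟩
    have h := hα (α⁻¹ x)
    rw [MulAut.apply_inv_self] at h
    rw [h]
    group

/-- `Aut_P(P)`: the inner automorphisms of `P`. -/
def innAut (P : Subgroup S) : Subgroup (MulAut P) := (MulAut.conj : P →* MulAut P).range

instance innAut_normal (P : Subgroup S) : (innAut P).Normal where
  conj_mem := by
    rintro _ ⟨x, rfl⟩ α
    exact ⟨α x, by ext y; simp⟩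

/-- For `φ : P → Q`, the group `N_φ` of all `g ∈ N_S P` such that
`φ ∘ c_g ∘ φ⁻¹ ∈ Aut_S(φ(P))`. -/
def extDomain {P Q : Subgroup S} (φ : P →* Q) : Subgroup S where
  carrier := {g | ∃ hg : g ∈ normS P, ∃ h ∈ normS (imageOf φ), ∀ x : P,
    (φ ⟨g * x * g⁻¹, (Subgroup.mem_normalizer_iff.1 hg x).1 x.2⟩ : S) = h * φ x * h⁻¹}
  one_mem' := ⟨one_mem _, 1, one_mem _, fun x => by simp⟩
  mul_mem' := by
    rintro a b ⟨ha, h, hh, hha⟩ ⟨hb, k, hk, hkb⟩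
    refine ⟨mul_mem ha hb, h * k, mul_mem hh hk, fun x => ?_⟩
    have h1 := hha ⟨b * x * b⁻¹, (Subgroup.mem_normalizer_iff.1 hb x).1 x.2⟩
    rw [hkb x] at h1
    simpa [mul_assoc] using h1
  inv_mem' := by
    rintro a ⟨ha, h, hh, hha⟩
    refine ⟨inv_mem ha, h⁻¹, inv_mem hh, fun x => ?_⟩
    have h1 := hha ⟨a⁻¹ * x * a⁻¹⁻¹, (Subgroup.mem_normalizer_iff.1 (inv_mem ha) x).1 x.2⟩
    have h2 : (⟨a * (a⁻¹ * x * a⁻¹⁻¹) * a⁻¹, (Subgroup.mem_normalizer_iff.1 ha _).1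
        ((Subgroup.mem_normalizer_iff.1 (inv_mem ha) x).1 x.2)⟩ : P) = x := by
      ext; simp [mul_assoc]
    simp only at h1
    rw [h2] at h1
    rw [h1]
    group

theorem le_extDomain {P Q : Subgroup S} (φ : P →* Q) : P ≤ extDomain φ := by
  intro g hg
  refine ⟨le_normS P hg, φ ⟨g, hg⟩, le_normS _ ⟨⟨g, hg⟩, rfl⟩, fun x => ?_⟩
  have : (⟨g * x * g⁻¹, (Subgroup.mem_normalizer_iff.1 (le_normS P hg) x).1 x.2⟩ : P)
      = ⟨g, hg⟩ * x * ⟨g, hg⟩⁻¹ := rfl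
  rw [this]
  simp

end Basic

/-- A fusion system over `S`: its objects are all subgroups of `S`, and its morphism sets consist
of injective homomorphisms, contain all conjugations by elements of `S`, and every morphism is an
isomorphism of the system followed by an inclusion. (Identities are conjugations by `1`.) -/
structure FusionSystem (S : Type u) [Group S] where
  Hom (P Q : Subgroup S) : Set (P →* Q)
  injective {P Q : Subgroup S} {φ : P →* Q} : φ ∈ Hom P Q → Function.Injective φ
  comp_mem {P Q R : Subgroup S} {φ : P →* Q} {ψ : Q →* R} :
    φ ∈ Hom P Q → ψ ∈ Hom Q R → ψ.comp φ ∈ Hom P R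
  conj_mem {P Q : Subgroup S} (g : S) (h : ∀ x ∈ P, g * x * g⁻¹ ∈ Q) : conjHom g h ∈ Hom P Q
  factor {P Q : Subgroup S} {φ : P →* Q} : φ ∈ Hom P Q →
    ∃ (R : Subgroup S) (hR : R ≤ Q) (e : P ≃* R), e.toMonoidHom ∈ Hom P R ∧
      e.symm.toMonoidHom ∈ Hom R P ∧ φ = (Subgroup.inclusion hR).comp e.toMonoidHom

namespace FusionSystem

variable {S : Type u} [Group S] (F : FusionSystem S)

theorem inclusion_mem {P Q : Subgroup S} (h : P ≤ Q) : Subgroup.inclusion h ∈ F.Hom P Q := by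
  have := F.conj_mem (P := P) (Q := Q) 1 (fun x hx => by simpa using h hx)
  convert this using 1
  ext x
  simp [conjHom]

theorem id_mem (P : Subgroup S) : MonoidHom.id P ∈ F.Hom P P := F.inclusion_mem le_rfl

/-- `P` and `Q` are `F`-conjugate, i.e. isomorphic in `F`. -/
def IsConj (P Q : Subgroup S) : Prop :=
  ∃ e : P ≃* Q, e.toMonoidHom ∈ F.Hom P Q ∧ e.symm.toMonoidHom ∈ F.Hom Q P

/-- `P` is fully centralized in `F`. -/
def IsFullyCentralized (p : ℕ) [Fact p.Prime] (P : Subgroup S) : Prop :=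
  ∀ Q : Subgroup S, F.IsConj P Q → toralSize p (centS Q) ≤ toralSize p (centS P)

/-- `P` is fully normalized in `F`. -/
def IsFullyNormalized (p : ℕ) [Fact p.Prime] (P : Subgroup S) : Prop :=
  ∀ Q : Subgroup S, F.IsConj P Q → toralSize p (normS Q) ≤ toralSize p (normS P)

/-- `P` is `F`-centric: every subgroup `F`-conjugate to `P` (in particular `P` itself) contains its
centralizer in `S`. -/
def IsCentric (P : Subgroup S) : Prop :=
  ∀ Q : Subgroup S, F.IsConj P Q → centS Q ≤ Q

/-- `Aut_F(P)`. -/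
def aut (P : Subgroup S) : Subgroup (MulAut P) where
  carrier := {α | α.toMonoidHom ∈ F.Hom P P ∧ α.symm.toMonoidHom ∈ F.Hom P P}
  one_mem' := ⟨F.id_mem P, F.id_mem P⟩
  mul_mem' := fun ha hb => ⟨F.comp_mem hb.1 ha.1, F.comp_mem ha.2 hb.2⟩
  inv_mem' := fun ha => ⟨ha.2, ha.1⟩

/-- `Out_F(P) = Aut_F(P) / Aut_P(P)`. -/
abbrev Out (P : Subgroup S) : Type u := F.aut P ⧸ (innAut P).subgroupOf (F.aut P)

/-- `Out_S(P)`, as a subgroup of `Out_F(P)`. -/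
def outS (P : Subgroup S) : Subgroup (F.Out P) :=
  ((autS P).subgroupOf (F.aut P)).map (QuotientGroup.mk' ((innAut P).subgroupOf (F.aut P)))

/-- Saturated fusion systems. -/
structure IsSaturated (p : ℕ) [Fact p.Prime] : Prop where
  sylow (P : Subgroup S) : F.IsFullyNormalized p P →
    F.IsFullyCentralized p P ∧ Finite (F.Out P) ∧
      ∃ T : Sylow p (F.Out P), (T : Subgroup (F.Out P)) = F.outS P
  extend (P : Subgroup S) (φ : P →* (⊤ : Subgroup S)) : φ ∈ F.Hom P ⊤ →
    F.IsFullyCentralized p (imageOf φ) →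
      ∃ ψ ∈ F.Hom (extDomain φ) ⊤, ψ.comp (Subgroup.inclusion (le_extDomain φ)) = φ
  union (P : ℕ → Subgroup S) : Monotone P → ∀ φ : (⨆ n, P n : Subgroup S) →* (⊤ : Subgroup S),
    (∀ n, φ.comp (Subgroup.inclusion (le_iSup P n)) ∈ F.Hom (P n) ⊤) →
      φ ∈ F.Hom (⨆ n, P n) ⊤

/-- The `F`-centric subgroups of `S`. -/
@[ext]
structure CentricSubgroup where
  grp : Subgroup S
  centric : F.IsCentric grp

variable {F}

theorem IsConj.trans {P Q R : Subgroup S} (h : F.IsConj P Q) (h' : F.IsConj Q R) :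
    F.IsConj P R := by
  obtain ⟨e, he, he'⟩ := h
  obtain ⟨f, hf, hf'⟩ := h'
  exact ⟨e.trans f, F.comp_mem he hf, F.comp_mem hf' he'⟩

theorem isConj_imageOf {P Q : Subgroup S} {φ : P →* Q} (h : φ ∈ F.Hom P Q) :
    F.IsConj P (imageOf φ) := by
  obtain ⟨R, hR, e, he, he', rfl⟩ := F.factor h
  have : imageOf ((Subgroup.inclusion hR).comp e.toMonoidHom) = R := by
    ext x
    constructor
    · rintro ⟨y, rfl⟩
      exact (e y).2
    · intro hx
      exact ⟨e.symm ⟨x, hx⟩, by simp⟩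
  rw [this]
  exact ⟨e, he, he'⟩

theorem IsCentric.of_conj {P Q : Subgroup S} (hP : F.IsCentric P) (h : F.IsConj P Q) :
    F.IsCentric Q := fun R hR => hP R (h.trans hR)

theorem IsCentric.of_le {P Q : Subgroup S} (hP : F.IsCentric P) (h : P ≤ Q) :
    F.IsCentric Q := by
  rintro R ⟨e, he, -⟩
  have hc := F.comp_mem (F.inclusion_mem h) he
  have h1 : imageOf (e.toMonoidHom.comp (Subgroup.inclusion h)) ≤ R := by
    rintro _ ⟨y, rfl⟩
    exact (e _).2
  exact (Subgroup.centralizer_le h1).trans ((hP _ (isConj_imageOf hc)).trans h1)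

variable (F)

/-- The morphism sets of the normalizer `N_F P`, for subgroups `Q`, `R` of `N_S P`: the morphisms
`Q → R` of `F` that extend to a morphism `Q · P → R · P` of `F` taking `P` onto `P`.
(As `Q` normalizes `P`, the product `Q · P` is the join `Q ⊔ P`.) -/
def normHom (P Q R : Subgroup S) : Set (Q →* R) :=
  {φ | φ ∈ F.Hom Q R ∧ ∃ φ' ∈ F.Hom (Q ⊔ P) (R ⊔ P),
    (∀ x : Q, (φ' (Subgroup.inclusion le_sup_left x) : S) = φ x) ∧ imageOn φ' P = P}

/-- `Q` and `R` are isomorphic in `N_F P`. -/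
def IsNormConj (P Q R : Subgroup S) : Prop :=
  ∃ e : Q ≃* R, e.toMonoidHom ∈ F.normHom P Q R ∧ e.symm.toMonoidHom ∈ F.normHom P R Q

/-- The subgroup `Q` of `N_S P` is `N_F P`-centric: every subgroup `R` of `N_S P` isomorphic to `Q`
in `N_F P` contains its centralizer in `N_S P`. -/
def IsNormCentric (P Q : Subgroup S) : Prop :=
  ∀ R ≤ normS P, F.IsNormConj P Q R → centS R ⊓ normS P ≤ R

theorem imageOn_comp {P Q R A B : Subgroup S} {φ : P →* Q} {ψ : Q →* R}
    (hφ : imageOn φ A = B) (hψ : imageOn ψ B = B) : imageOn (ψ.comp φ) A = B := by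
  rw [← hψ]
  ext z
  constructor
  · rintro ⟨x, hx, rfl⟩
    exact ⟨φ x, hφ.le ⟨x, hx, rfl⟩, rfl⟩
  · rintro ⟨y, hy, rfl⟩
    obtain ⟨x, hx, hxy⟩ := hφ.ge hy
    exact ⟨x, hx, by
      have : φ x = y := Subtype.ext hxy
      simp [this]⟩

theorem imageOn_id {Q P : Subgroup S} (h : P ≤ Q) : imageOn (MonoidHom.id Q) P = P := by
  ext z
  constructor
  · rintro ⟨x, hx, rfl⟩
    exact hx
  · intro hz
    exact ⟨⟨z, h hz⟩, hz, rfl⟩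

theorem normHom_id (P Q : Subgroup S) : MonoidHom.id Q ∈ F.normHom P Q Q :=
  ⟨F.id_mem Q, MonoidHom.id _, F.id_mem _, fun _ => rfl, imageOn_id le_sup_right⟩

theorem normHom_comp {P Q R T : Subgroup S} {φ : Q →* R} {ψ : R →* T}
    (hφ : φ ∈ F.normHom P Q R) (hψ : ψ ∈ F.normHom P R T) : ψ.comp φ ∈ F.normHom P Q T := by
  obtain ⟨h1, φ', h2, h3, h4⟩ := hφ
  obtain ⟨k1, ψ', k2, k3, k4⟩ := hψ
  refine ⟨F.comp_mem h1 k1, ψ'.comp φ', F.comp_mem h2 k2, fun x => ?_, imageOn_comp h4 k4⟩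
  have : φ' (Subgroup.inclusion le_sup_left x) = Subgroup.inclusion le_sup_left (φ x) :=
    Subtype.ext (h3 x)
  simp [this, k3]

theorem IsCentric.isNormCentric {F : FusionSystem S} {P Q : Subgroup S} (hQ : F.IsCentric Q) :
    F.IsNormCentric P Q := by
  rintro R - ⟨e, he, he'⟩
  exact inf_le_left.trans (hQ R ⟨e, he.1, he'.1⟩)

end FusionSystem

/-! ### Centric linking systems -/

/-- A centric linking system associated to `F`: a category whose objects are the `F`-centric
subgroups of `S`, with a functor `π` to `F` that is the identity on objects, and injective
homomorphisms `δ P : P → Aut(P)`. In Mathlib, `f ≫ g` is the composite `g ∘ f`, and multiplication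
in `Aut P` is `f * g = f ∘ g`. -/
structure CentricLinkingSystem {S : Type u} [Group S] (F : FusionSystem S) where
  [cat : Category.{w} F.CentricSubgroup]
  /-- The functor `π` on morphisms. -/
  π {P Q : F.CentricSubgroup} (f : P ⟶ Q) : P.grp →* Q.grp
  π_mem {P Q : F.CentricSubgroup} (f : P ⟶ Q) : π f ∈ F.Hom P.grp Q.grp
  π_id (P : F.CentricSubgroup) : π (𝟙 P) = MonoidHom.id P.grp
  π_comp {P Q R : F.CentricSubgroup} (f : P ⟶ Q) (g : Q ⟶ R) : π (f ≫ g) = (π g).comp (π f)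
  /-- The distinguished monomorphisms. -/
  δ (P : F.CentricSubgroup) : P.grp →* Aut P
  δ_injective (P : F.CentricSubgroup) : Function.Injective (δ P)
  /-- `Z(P)` acts freely on the morphisms from `P`. -/
  free {P Q : F.CentricSubgroup} (f : P ⟶ Q) (z : P.grp) :
    z ∈ Subgroup.center P.grp → (δ P z).hom ≫ f = f → z = 1
  /-- `π` is surjective onto the morphism sets of `F`. -/
  π_surj {P Q : F.CentricSubgroup} (φ : P.grp →* Q.grp) : φ ∈ F.Hom P.grp Q.grp → ∃ f : P ⟶ Q, π f = φ
  /-- The fibres of `π` are the orbits of `Z(P)`. -/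
  π_eq_iff {P Q : F.CentricSubgroup} (f g : P ⟶ Q) :
    π f = π g ↔ ∃ z ∈ Subgroup.center P.grp, g = (δ P z).hom ≫ f
  π_δ (P : F.CentricSubgroup) (g x : P.grp) : π (δ P g).hom x = g * x * g⁻¹
  δ_comm {P Q : F.CentricSubgroup} (f : P ⟶ Q) (g : P.grp) :
    (δ P g).hom ≫ f = f ≫ (δ Q (π f g)).hom

namespace CentricLinkingSystem

variable {S : Type u} [Group S] {F : FusionSystem S} (L : CentricLinkingSystem.{u, w} F)

/-- The objects of `L`. -/
@[nolint unusedArguments]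
def Obj (_ : CentricLinkingSystem.{u, w} F) : Type u := F.CentricSubgroup

instance : Category.{w} L.Obj := L.cat

variable {L}

/-- The subgroup of `S` underlying an object of `L`. -/
def Obj.grp (P : L.Obj) : Subgroup S := FusionSystem.CentricSubgroup.grp P

theorem Obj.centric (P : L.Obj) : F.IsCentric P.grp := FusionSystem.CentricSubgroup.centric P

/-- The homomorphism `π(f)` of `F` underlying a morphism `f` of `L`. -/
def proj {P Q : L.Obj} (f : P ⟶ Q) : P.grp →* Q.grp := L.π f

theorem proj_mem {P Q : L.Obj} (f : P ⟶ Q) : proj f ∈ F.Hom P.grp Q.grp := L.π_mem f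

theorem proj_id (P : L.Obj) : proj (𝟙 P) = MonoidHom.id P.grp := L.π_id P

theorem proj_comp {P Q R : L.Obj} (f : P ⟶ Q) (g : Q ⟶ R) :
    proj (f ≫ g) = (proj g).comp (proj f) := L.π_comp f g

/-- An overgroup of an object of `L`, as an object of `L`. -/
def Obj.over (P : L.Obj) (Q : Subgroup S) (h : P.grp ≤ Q) : L.Obj :=
  ⟨Q, FusionSystem.IsCentric.of_le P.centric h⟩

/-- `N_S P`, as an object of `L`. -/
def Obj.norm (P : L.Obj) : L.Obj := P.over (normS P.grp) (le_normS P.grp)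

/-- For `φ : P → Q` in `L`, the object `P_φ = π(φ)(P)`. -/
def imageObj {P Q : L.Obj} (φ : P ⟶ Q) : L.Obj :=
  ⟨imageOf (proj φ), FusionSystem.IsCentric.of_conj P.centric
    (FusionSystem.isConj_imageOf (proj_mem φ))⟩

theorem imageObj_le {P Q : L.Obj} (φ : P ⟶ Q) : (imageObj φ).grp ≤ Q.grp := by
  rintro _ ⟨x, rfl⟩
  exact (proj φ x).2

/-- For `φ : P → Q` in `L`, the object `N_S(P_φ) ∩ Q`. -/
def normInObj {P Q : L.Obj} (φ : P ⟶ Q) : L.Obj :=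
  (imageObj φ).over (normS (imageObj φ).grp ⊓ Q.grp) (le_inf (le_normS _) (imageObj_le φ))

variable (L)

/-- A compatible choice of morphisms `ι_P^Q : P → Q` in `L` lifting the inclusions `P ⊆ Q`. -/
structure Inclusions where
  ι {P Q : L.Obj} (h : P.grp ≤ Q.grp) : P ⟶ Q
  proj_ι {P Q : L.Obj} (h : P.grp ≤ Q.grp) : proj (ι h) = Subgroup.inclusion h
  ι_refl (P : L.Obj) : ι (le_refl P.grp) = 𝟙 P
  ι_trans {P Q R : L.Obj} (h : P.grp ≤ Q.grp) (h' : Q.grp ≤ R.grp) :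
    ι h ≫ ι h' = ι (h.trans h')

variable {L}

/-! ### The normalizer `N_L P` and the undercategories -/

/-- The objects of `N_L P`: the `N_F P`-centric subgroups of `N_S P`. -/
structure NormObj (P : L.Obj) where
  grp : Subgroup S
  le_norm : grp ≤ normS P.grp
  centric : F.IsNormCentric P.grp grp

/-- The object `Q · P` of `L`, for an object `Q` of `N_L P`. -/
def NormObj.prod {P : L.Obj} (Q : NormObj P) : L.Obj := P.over (Q.grp ⊔ P.grp) le_sup_right

theorem NormObj.prod_le {P : L.Obj} (Q : NormObj P) : Q.prod.grp ≤ P.norm.grp :=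
  sup_le Q.le_norm (le_normS P.grp)

theorem NormObj.le_prod {P : L.Obj} (Q : NormObj P) : P.grp ≤ Q.prod.grp :=
  le_sup_right (a := Q.grp)

theorem NormObj.grp_le_prod {P : L.Obj} (Q : NormObj P) : Q.grp ≤ Q.prod.grp :=
  le_sup_left (b := P.grp)

/-- `φ : Q · P → R · P` in `L` is a morphism `Q → R` of `N_L P`: the restriction of `π(φ)` to `Q` is
a morphism `Q → R` of `N_F P`, and `π(φ)(P) = P`. -/
def IsNormMor {P : L.Obj} (Q R : NormObj P) (φ : Q.prod ⟶ R.prod) : Prop :=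
  (∃ ψ ∈ F.normHom P.grp Q.grp R.grp,
    ∀ x : Q.grp, (proj φ (Subgroup.inclusion Q.grp_le_prod x) : S) = ψ x) ∧
  imageOn (proj φ) P.grp = P.grp

/-- The category `N_L P`. -/
instance (P : L.Obj) : Category.{w} (NormObj P) where
  Hom Q R := {φ : Q.prod ⟶ R.prod // IsNormMor Q R φ}
  id Q := ⟨𝟙 _, ⟨MonoidHom.id _, F.normHom_id _ _, fun x => by rw [proj_id]; rfl⟩, by
    rw [proj_id]
    exact FusionSystem.imageOn_id Q.le_prod⟩
  comp {Q R T} f g := ⟨f.1 ≫ g.1, by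
    obtain ⟨f, ⟨ψ, hψ, h1⟩, h2⟩ := f
    obtain ⟨g, ⟨χ, hχ, k1⟩, k2⟩ := g
    rw [IsNormMor, proj_comp]
    refine ⟨⟨χ.comp ψ, F.normHom_comp hψ hχ, fun x => ?_⟩, FusionSystem.imageOn_comp h2 k2⟩
    have : proj f (Subgroup.inclusion Q.grp_le_prod x) =
        Subgroup.inclusion R.grp_le_prod (ψ x) := Subtype.ext (h1 x)
    rw [MonoidHom.comp_apply, MonoidHom.comp_apply, this, k1]⟩
  id_comp f := Subtype.ext (Category.id_comp f.1)
  comp_id f := Subtype.ext (Category.comp_id f.1)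
  assoc f g h := Subtype.ext (Category.assoc f.1 g.1 h.1)

/-- `P`, as an object of `N_L P`. -/
def Obj.inNorm (P : L.Obj) : NormObj P where
  grp := P.grp
  le_norm := le_normS P.grp
  centric := FusionSystem.IsCentric.isNormCentric P.centric

theorem Obj.eq_prod (P : L.Obj) : P = P.inNorm.prod :=
  FusionSystem.CentricSubgroup.ext (sup_idem P.grp).symm

/-- The undercategory `P ↓ N_L P`. -/
abbrev NormUnder (P : L.Obj) := Under P.inNorm

/-- The inclusion functor `i : (P ↓ N_L P) ⥤ (P ↓ L)`. It regards `P → Q` in `N_L P`, which is a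
morphism `P · P → Q · P` of `L`, as a morphism of `L` with source `P = P · P`; here `Q · P = Q`
since `Q` contains `P`. -/
def underIncl (P : L.Obj) : NormUnder P ⥤ Under P where
  obj φ := Under.mk (eqToHom P.eq_prod ≫ φ.hom.1)
  map {φ ψ} f := Under.homMk f.right.1 (by
    have h : φ.hom ≫ f.right = ψ.hom := Under.w f
    have h' : φ.hom.1 ≫ f.right.1 = ψ.hom.1 := congrArg Subtype.val h
    simp [h'])
  map_id φ := by ext; rfl
  map_comp f g := by ext; rfl

/-- The objects of `P ↓ L` that are not isomorphisms of `L`. -/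
def nonIso (P : L.Obj) : ObjectProperty (Under P) := fun φ => ¬ IsIso φ.hom

/-- The objects of `P ↓ N_L P` that are not isomorphisms of `L`. -/
def normNonIso (P : L.Obj) : ObjectProperty (NormUnder P) :=
  fun φ => ¬ IsIso ((underIncl P).obj φ).hom

/-- The full subcategory of `P ↓ L` of non-isomorphisms. -/
abbrev UnderNonIso (P : L.Obj) := (nonIso P).FullSubcategory

/-- The full subcategory of `P ↓ N_L P` of non-isomorphisms. -/
abbrev NormUnderNonIso (P : L.Obj) := (normNonIso P).FullSubcategory

/-- The restriction of the inclusion functor to non-isomorphisms. -/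
def underInclNonIso (P : L.Obj) : NormUnderNonIso P ⥤ UnderNonIso P :=
  (nonIso P).lift ((normNonIso P).ι ⋙ underIncl P) (fun φ => φ.property)

/-- The restriction to non-isomorphisms of a functor that preserves non-isomorphisms. -/
def restrictNonIso {P : L.Obj} (r : Under P ⥤ NormUnder P)
    (hr : ∀ φ, nonIso P φ → normNonIso P (r.obj φ)) : UnderNonIso P ⥤ NormUnderNonIso P :=
  (normNonIso P).lift ((nonIso P).ι ⋙ r) (fun φ => hr φ.obj φ.property)

/-! ### The retraction -/

/-- The choices made in the construction of the retraction: for every object `φ : P → Q` of `P ↓ L`,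
a morphism `F_φ : N_S(P_φ) → N_S P` of `L` whose underlying homomorphism `f_φ` maps `P_φ` onto `P`,
and which is the identity if `P_φ = P`. -/
structure RetractionChoice (P : L.Obj) where
  lift (φ : Under P) : (imageObj φ.hom).norm ⟶ P.norm
  image_eq (φ : Under P) : imageOn (proj (lift φ)) (imageObj φ.hom).grp = P.grp
  lift_eq_id (φ : Under P) (h : imageObj φ.hom = P) : lift φ = eqToHom (congrArg Obj.norm h)

/-- The object `ρ` of `P ↓ N_L P` and the morphism `η : ρ → φ` of `P ↓ L` are those constructed from
the object `φ : P → Q` and the chosen morphism `F_φ`: the target of `ρ` is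
`T = f_φ(N_S(P_φ) ∩ Q)`, and if `φ₀ : P → P_φ` is the corestriction of `φ`, and
`F₁ : N_S(P_φ) ∩ Q ≅ T` and `F₂ : P_φ ≅ P` are the isomorphisms obtained by restricting and
corestricting `F_φ`, then `ρ = ι_P^T ∘ F₂ ∘ φ₀` and `η = ι ∘ F₁⁻¹ : T → N_S(P_φ) ∩ Q → Q`. -/
def IsRetractionAt {P : L.Obj} (I : L.Inclusions) (c : RetractionChoice P) (φ : Under P)
    (ρ : NormUnder P) (η : (underIncl P).obj ρ ⟶ φ) : Prop :=
  ρ.right.grp = imageOn (proj (c.lift φ)) (normInObj φ.hom).grp ∧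
  ∃ (φ₀ : P ⟶ imageObj φ.hom) (F₁ : normInObj φ.hom ≅ ρ.right.prod) (F₂ : imageObj φ.hom ≅ P),
    φ₀ ≫ I.ι (imageObj_le φ.hom) = φ.hom ∧
    F₁.hom ≫ I.ι ρ.right.prod_le =
      I.ι (Q := (imageObj φ.hom).norm) (inf_le_left (b := φ.right.grp)) ≫ c.lift φ ∧
    F₂.hom ≫ I.ι (Q := P.norm) (le_normS P.grp) =
      I.ι (Q := (imageObj φ.hom).norm) (le_normS _) ≫ c.lift φ ∧
    ((underIncl P).obj ρ).hom = φ₀ ≫ F₂.hom ≫ I.ι ρ.right.le_prod ∧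
    η.right = F₁.inv ≫ I.ι (inf_le_right (a := normS (imageObj φ.hom).grp))

end CentricLinkingSystem

/-! ### Homotopy equivalences of nerves -/

/-- The continuous map `|C| → |D|` induced by a functor on geometric realizations of nerves. -/
noncomputable def nerveRealization {C D : Type u} [Category.{w} C] [Category.{w} D] (G : C ⥤ D) :
    C(SSet.toTop.obj (nerve C), SSet.toTop.obj (nerve D)) :=
  (SSet.toTop.map (nerveMap G)).hom

/-- `G` induces a homotopy equivalence of nerves, with homotopy inverse induced by `H`. -/
def IsNerveEquivWithInverse {C D : Type u} [Category.{w} C] [Category.{w} D]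
    (G : C ⥤ D) (H : D ⥤ C) : Prop :=
  ((nerveRealization H).comp (nerveRealization G)).Homotopic (ContinuousMap.id _) ∧
  ((nerveRealization G).comp (nerveRealization H)).Homotopic (ContinuousMap.id _)

open CentricLinkingSystem

section NerveHomotopy

open Simplicial Opposite

/-- The partial sum of the coordinates of `t` with index less than `a`. -/
noncomputable def partialSum {n : ℕ} (t : Fin (n + 1) → ℝ) (a : ℕ) : ℝ :=
  ∑ i : Fin (n + 1), if (i : ℕ) < a then t i else 0

section PartialSum

variable {n : ℕ}

theorem partialSum_zero (t : Fin (n + 1) → ℝ) : partialSum t 0 = 0 := by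
  simp [partialSum]

theorem partialSum_succ (t : Fin (n + 1) → ℝ) (i : Fin (n + 1)) :
    partialSum t (i + 1) = partialSum t i + t i := by
  have : t i = ∑ j, if j = i then t j else 0 := by simp
  rw [this, partialSum, partialSum, ← Finset.sum_add_distrib]
  refine Finset.sum_congr rfl fun j _ => ?_
  by_cases h : j = i
  · subst h; simp
  · have h' : (j : ℕ) ≠ i := fun e => h (Fin.ext e)
    have : (j : ℕ) < i + 1 ↔ (j : ℕ) < i := by lia
    simp [h, this]

theorem partialSum_of_le (t : stdSimplex ℝ (Fin (n + 1))) {a : ℕ} (h : n + 1 ≤ a) :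
    partialSum t a = 1 := by
  rw [← stdSimplex.sum_eq_one t]
  exact Finset.sum_congr rfl fun j _ => if_pos (by lia)

theorem partialSum_mono (t : stdSimplex ℝ (Fin (n + 1))) : Monotone (partialSum t) := by
  intro a b h
  refine Finset.sum_le_sum fun i _ => ?_
  have := stdSimplex.zero_le t i
  split_ifs <;> first | rfl | assumption | lia

theorem partialSum_nonneg (t : stdSimplex ℝ (Fin (n + 1))) (a : ℕ) : 0 ≤ partialSum t a :=
  (partialSum_zero _).ge.trans (partialSum_mono t (Nat.zero_le a))

theorem partialSum_le_one (t : stdSimplex ℝ (Fin (n + 1))) (a : ℕ) : partialSum t a ≤ 1 :=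
  (partialSum_mono t (le_max_left a (n + 1))).trans
    (partialSum_of_le t (le_max_right a (n + 1))).le

theorem stdSimplex_ext_partialSum {x y : stdSimplex ℝ (Fin (n + 1))}
    (h : ∀ a ≤ n + 1, partialSum x a = partialSum y a) : x = y := by
  refine stdSimplex.ext (funext fun i => ?_)
  have h1 := partialSum_succ x i
  have h2 := partialSum_succ y i
  rw [h _ (by lia), h _ (by lia)] at h1
  linarith

theorem continuous_partialSum (a : ℕ) :
    Continuous fun t : stdSimplex ℝ (Fin (n + 1)) => partialSum t a := by
  refine continuous_finsetSum _ fun i _ => ?_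
  split_ifs
  · exact (continuous_apply i).comp continuous_subtype_val
  · exact continuous_const

theorem partialSum_map {m : ℕ} (f : Fin (m + 1) → Fin (n + 1)) (t : stdSimplex ℝ (Fin (m + 1)))
    {j a : ℕ} (h : ∀ i, (f i : ℕ) < j ↔ (i : ℕ) < a) :
    partialSum (stdSimplex.map f t) j = partialSum t a := by
  simp only [partialSum, stdSimplex.map_coe, FunOnFinite.linearMap_apply_apply]
  simp only [← h]
  rw [← Finset.sum_fiberwise (s := Finset.univ) (g := f)]
  refine Finset.sum_congr rfl fun l _ => ?_
  by_cases hl : (l : ℕ) < j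
  · rw [if_pos hl]
    refine Finset.sum_congr rfl fun i hi => ?_
    rw [if_pos]
    simp at hi; rwa [hi]
  · rw [if_neg hl]
    refine (Finset.sum_eq_zero fun i hi => ?_).symm
    rw [if_neg]
    simp at hi; rwa [hi]

/-- For monotone `f`, the indices `i` with `f i < j` form an initial segment. -/
theorem exists_initial_segment {m : ℕ} (f : Fin (m + 1) →o Fin (n + 1)) (j : ℕ) :
    ∃ a ≤ m + 1, ∀ i, (f i : ℕ) < j ↔ (i : ℕ) < a := by
  classical
  by_cases h : ∃ a, ∃ ha : a < m + 1, j ≤ (f ⟨a, ha⟩ : ℕ)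
  · obtain ⟨ha, hj⟩ := Nat.find_spec h
    refine ⟨Nat.find h, ha.le, fun i => ⟨fun hi => ?_, fun hi => ?_⟩⟩
    · by_contra hc
      have : f ⟨Nat.find h, ha⟩ ≤ f i := f.monotone (by simpa [Fin.le_def] using hc)
      have : (f ⟨Nat.find h, ha⟩ : ℕ) ≤ f i := this
      lia
    · by_contra hc
      exact Nat.find_min h hi ⟨i.2, by simpa using hc⟩
  · refine ⟨m + 1, le_rfl, fun i => ⟨fun _ => i.2, fun _ => ?_⟩⟩
    by_contra hc
    exact h ⟨i, i.2, by simpa using hc⟩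

/-- The point of the simplex with prescribed partial sums. -/
noncomputable def ofPartialSum (c : ℕ → ℝ) (h0 : c 0 = 0) (h1 : c (n + 1) = 1) (hc : Monotone c) :
    stdSimplex ℝ (Fin (n + 1)) :=
  ⟨fun i => c (i + 1) - c i, fun i => sub_nonneg.2 (hc (Nat.le_succ _)), by
    rw [Fin.sum_univ_eq_sum_range (fun i => c (i + 1) - c i) (n + 1), Finset.sum_range_sub, h0, h1,
      sub_zero]⟩

theorem partialSum_ofPartialSum (c : ℕ → ℝ) (h0 : c 0 = 0) (h1 : c (n + 1) = 1) (hc : Monotone c)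
    {a : ℕ} (ha : a ≤ n + 1) : partialSum (ofPartialSum c h0 h1 hc) a = c a := by
  induction a with
  | zero => rw [partialSum_zero, h0]
  | succ a ih =>
    have := partialSum_succ (ofPartialSum c h0 h1 hc) ⟨a, by lia⟩
    simp only at this
    rw [this, ih (by lia)]
    change c a + (c (a + 1) - c a) = _
    ring

end PartialSum

section Prism

variable {n : ℕ}

/-- The sequence of partial sums of `t` with `s`, moved into the interval between the partial sums
number `k` and `k + 1`, inserted. -/
noncomputable def insertSum (k : ℕ) (t : stdSimplex ℝ (Fin (n + 1))) (s : ℝ) (a : ℕ) : ℝ :=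
  if a ≤ k then partialSum t a else if a = k + 1 then
    max (partialSum t k) (min s (partialSum t (k + 1))) else partialSum t (a - 1)

theorem insertSum_mono (k : ℕ) (t : stdSimplex ℝ (Fin (n + 1))) (s : ℝ) :
    Monotone (insertSum k t s) := by
  have hm := partialSum_mono t
  refine monotone_nat_of_le_succ fun a => ?_
  have h1 : partialSum t k ≤ partialSum t (k + 1) := hm (Nat.le_succ _)
  rcases lt_trichotomy a k with h | rfl | h
  · rw [insertSum, insertSum, if_pos h.le, if_pos (by lia)]
    exact hm (Nat.le_succ _)
  · simp [insertSum]
  · rcases eq_or_lt_of_le (Nat.succ_le_of_lt h) with rfl | h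
    · simp [insertSum, h1]
    · rw [insertSum, insertSum, if_neg (by lia), if_neg (by lia), if_neg (by lia), if_neg (by lia)]
      exact hm (by lia)

/-- The `k`-th piece of the decomposition of the prism over the simplex. -/
def prismPiece (k : Fin (n + 1)) : Set (stdSimplex ℝ (Fin (n + 1)) × unitInterval) :=
  {q | partialSum q.1 k ≤ q.2 ∧ (q.2 : ℝ) ≤ partialSum q.1 (k + 1)}

theorem isClosed_prismPiece (k : Fin (n + 1)) : IsClosed (prismPiece k) :=
  (isClosed_le ((continuous_partialSum _).comp continuous_fst)
    (continuous_subtype_val.comp continuous_snd)).inter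
  (isClosed_le (continuous_subtype_val.comp continuous_snd)
    ((continuous_partialSum _).comp continuous_fst))

theorem exists_mem_prismPiece (q : stdSimplex ℝ (Fin (n + 1)) × unitInterval) :
    ∃ k, q ∈ prismPiece k := by
  classical
  have h : ∃ a, (q.2 : ℝ) ≤ partialSum q.1 (a + 1) :=
    ⟨n, (partialSum_of_le q.1 le_rfl).ge.trans' q.2.2.2⟩
  have hn : Nat.find h ≤ n := Nat.find_min' h ((partialSum_of_le q.1 le_rfl).ge.trans' q.2.2.2)
  refine ⟨⟨Nat.find h, by lia⟩, ?_, Nat.find_spec h⟩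
  change partialSum q.1 (Nat.find h) ≤ _
  rcases Nat.eq_zero_or_pos (Nat.find h) with h0 | h0
  · rw [h0, partialSum_zero]
    exact q.2.2.1
  · have := Nat.find_min h (m := Nat.find h - 1) (by lia)
    rw [Nat.sub_add_cancel h0] at this
    exact (not_le.1 this).le

/-- The map from the prism over the `n`-simplex to the `n + 1`-simplex that is inverse to the
`k`-th simplex of the prism on the `k`-th piece. -/
noncomputable def prismCoord (k : Fin (n + 1))
    (q : stdSimplex ℝ (Fin (n + 1)) × unitInterval) : stdSimplex ℝ (Fin (n + 2)) :=
  ofPartialSum (insertSum k q.1 q.2) (by simp [insertSum, partialSum_zero])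
    (by
      have := k.2
      rw [insertSum, if_neg (by lia), if_neg (by lia)]
      exact partialSum_of_le _ (by lia))
    (insertSum_mono _ _ _)

theorem partialSum_prismCoord (k : Fin (n + 1)) {q : stdSimplex ℝ (Fin (n + 1)) × unitInterval}
    (hq : q ∈ prismPiece k) {a : ℕ} (ha : a ≤ n + 2) : partialSum (prismCoord k q) a =
      if a ≤ k then partialSum q.1 a else if a = k + 1 then (q.2 : ℝ)
        else partialSum q.1 (a - 1) := by
  rw [prismCoord, partialSum_ofPartialSum _ _ _ _ ha, insertSum, min_eq_left hq.2,
    max_eq_right hq.1]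

theorem continuous_prismCoord (k : Fin (n + 1)) : Continuous (prismCoord k) := by
  have h (a : ℕ) : Continuous fun q : stdSimplex ℝ (Fin (n + 1)) × unitInterval =>
      insertSum k q.1 q.2 a := by
    have hp (a : ℕ) : Continuous fun q : stdSimplex ℝ (Fin (n + 1)) × unitInterval =>
      partialSum q.1 a := (continuous_partialSum a).comp continuous_fst
    unfold insertSum
    split_ifs
    · exact hp _
    · exact (hp _).max ((continuous_subtype_val.comp continuous_snd).min (hp _))
    · exact hp _
  exact Continuous.subtype_mk (continuous_pi fun i => (h _).sub (h _)) _

/-- The first coordinate of the `k`-th simplex of the prism. -/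
def prismFst (k : Fin (n + 1)) : Fin (n + 2) →o Fin 2 where
  toFun i := if (i : ℕ) ≤ k then 0 else 1
  monotone' i j h := by
    have : (i : ℕ) ≤ j := h
    dsimp only
    split_ifs
    · exact le_rfl
    · exact Fin.zero_le _
    · lia
    · exact le_rfl

/-- The second coordinate of the `k`-th simplex of the prism. -/
def prismSnd (k : Fin (n + 1)) : Fin (n + 2) →o Fin (n + 1) where
  toFun i := ⟨if (i : ℕ) ≤ k then i else i - 1, by split_ifs <;> lia⟩
  monotone' i j h := by
    have : (i : ℕ) ≤ j := h
    simp only [Fin.mk_le_mk]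
    split_ifs <;> lia

/-- The lift to the simplices of the prisms with numbers `k` and `f k` of the map of prisms
induced by `f`. -/
def prismMap {m : ℕ} (f : Fin (m + 1) →o Fin (n + 1)) (k : Fin (m + 1)) :
    Fin (m + 2) →o Fin (n + 2) where
  toFun i := if (i : ℕ) ≤ k then (f (prismSnd k i)).castSucc else (f (prismSnd k i)).succ
  monotone' i j h := by
    have h1 : f (prismSnd k i) ≤ f (prismSnd k j) := f.monotone ((prismSnd k).monotone h)
    have : (i : ℕ) ≤ j := h
    dsimp only
    split_ifs
    · exact Fin.castSucc_le_castSucc_iff.2 h1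
    · exact (Fin.castSucc_le_castSucc_iff.2 h1).trans (Fin.castSucc_le_succ _)
    · lia
    · exact Fin.succ_le_succ_iff.2 h1

theorem prismFst_apply (k : Fin (n + 1)) (i : Fin (n + 2)) :
    prismFst k i = if (i : ℕ) ≤ k then 0 else 1 := rfl

theorem prismSnd_apply (k : Fin (n + 1)) (i : Fin (n + 2)) :
    prismSnd k i = ⟨if (i : ℕ) ≤ k then i else i - 1, by split_ifs <;> lia⟩ := rfl

theorem prismMap_apply {m : ℕ} (f : Fin (m + 1) →o Fin (n + 1)) (k : Fin (m + 1))
    (i : Fin (m + 2)) : prismMap f k i =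
      if (i : ℕ) ≤ k then (f (prismSnd k i)).castSucc else (f (prismSnd k i)).succ := rfl

theorem prismSnd_le {k : Fin (n + 1)} {i : Fin (n + 2)} (h : (i : ℕ) ≤ k) : prismSnd k i ≤ k := by
  rw [prismSnd_apply, Fin.le_def]
  simp [h]

theorem le_prismSnd {k : Fin (n + 1)} {i : Fin (n + 2)} (h : ¬ (i : ℕ) ≤ k) :
    k ≤ prismSnd k i := by
  rw [prismSnd_apply, Fin.le_def]
  simp only [h, if_false]
  lia

theorem prismMap_fst {m : ℕ} (f : Fin (m + 1) →o Fin (n + 1)) (k : Fin (m + 1)) :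
    (prismFst (f k)).comp (prismMap f k) = prismFst k := by
  refine OrderHom.ext _ _ (funext fun i => ?_)
  simp only [OrderHom.comp_coe, Function.comp_apply, prismFst_apply, prismMap_apply]
  by_cases h : (i : ℕ) ≤ k
  · have := Fin.le_def.1 (f.monotone (prismSnd_le h))
    simp [h, this]
  · have := Fin.le_def.1 (f.monotone (le_prismSnd h))
    simp only [h, if_false, Fin.val_succ]
    rw [if_neg (by lia)]

theorem prismMap_snd {m : ℕ} (f : Fin (m + 1) →o Fin (n + 1)) (k : Fin (m + 1)) :
    (prismSnd (f k)).comp (prismMap f k) = f.comp (prismSnd k) := by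
  refine OrderHom.ext _ _ (funext fun i => Fin.ext ?_)
  simp only [OrderHom.comp_coe, Function.comp_apply, prismSnd_apply (f k), prismMap_apply]
  by_cases h : (i : ℕ) ≤ k
  · have := Fin.le_def.1 (f.monotone (prismSnd_le h))
    simp [h, this]
  · have := Fin.le_def.1 (f.monotone (le_prismSnd h))
    simp only [h, if_false, Fin.val_succ]
    rw [if_neg (by lia)]
    rfl

theorem map_mem_prismPiece {m : ℕ} (f : Fin (m + 1) →o Fin (n + 1)) {k : Fin (m + 1)}
    {q : stdSimplex ℝ (Fin (m + 1)) × unitInterval} (hq : q ∈ prismPiece k) :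
    (stdSimplex.map f q.1, q.2) ∈ prismPiece (f k) := by
  obtain ⟨a, -, h⟩ := exists_initial_segment f (f k)
  obtain ⟨b, -, h'⟩ := exists_initial_segment f (f k + 1)
  refine ⟨?_, ?_⟩
  · change partialSum (stdSimplex.map f q.1) _ ≤ _
    rw [partialSum_map f q.1 h]
    refine (partialSum_mono _ ?_).trans hq.1
    have := h k
    lia
  · change _ ≤ partialSum (stdSimplex.map f q.1) _
    rw [partialSum_map f q.1 h']
    refine hq.2.trans (partialSum_mono _ ?_)
    have := h' k
    lia

theorem map_prismCoord {m : ℕ} (f : Fin (m + 1) →o Fin (n + 1)) {k : Fin (m + 1)}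
    {q : stdSimplex ℝ (Fin (m + 1)) × unitInterval} (hq : q ∈ prismPiece k) :
    stdSimplex.map (prismMap f k) (prismCoord k q) =
      prismCoord (f k) (stdSimplex.map f q.1, q.2) := by
  refine stdSimplex_ext_partialSum fun j hj => ?_
  rw [partialSum_prismCoord _ (map_mem_prismPiece f hq) hj]
  obtain ⟨a, ha, h⟩ := exists_initial_segment (prismMap f k) j
  rw [partialSum_map _ _ h, partialSum_prismCoord _ hq ha]
  have e1 (i : Fin (m + 2)) (hi : (i : ℕ) ≤ k) : (prismMap f k i : ℕ) = f ⟨i, by lia⟩ := by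
    simp [prismMap_apply, prismSnd_apply, hi]
  have e2 (i : Fin (m + 2)) (hi : (k : ℕ) < i) : (prismMap f k i : ℕ) = f ⟨i - 1, by lia⟩ + 1 := by
    simp [prismMap_apply, prismSnd_apply, hi.not_ge]
  have fm (i j : Fin (m + 1)) (h : (i : ℕ) ≤ j) : (f i : ℕ) ≤ f j := f.monotone h
  have hk1 := h ⟨k, by lia⟩
  rw [e1 _ le_rfl] at hk1
  have hk2 := h ⟨k + 1, by lia⟩
  rw [e2 _ (by simp)] at hk2
  simp only [Nat.add_sub_cancel, Fin.eta] at hk1 hk2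
  rcases lt_trichotomy j (f k + 1) with hj' | rfl | hj'
  · rw [if_pos (by lia), if_pos (by lia)]
    refine (partialSum_map f q.1 fun i => ?_).symm
    by_cases hi : (i : ℕ) ≤ k
    · have := h i.castSucc
      rw [e1 _ hi] at this
      exact this
    · have := fm k i (by lia)
      lia
  · have : a = k + 1 := by lia
    rw [if_neg (by lia), if_pos this, if_neg (by lia), if_pos rfl]
  · rw [if_neg (by lia), if_neg (by lia), if_neg (by lia), if_neg (by lia)]
    refine (partialSum_map f q.1 fun i => ?_).symm
    by_cases hi : (i : ℕ) < k
    · have := fm i k (by lia)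
      lia
    · have := h i.succ
      rw [e2 _ (by simp; lia)] at this
      simp at this
      lia

end Prism

section Prism

variable {n : ℕ}

/-- The monotone map that sends the indices in the half-open interval from `k` to `l` to `k`. -/
def collapse (k l : Fin (n + 1)) : Fin (n + 2) →o Fin (n + 2) where
  toFun i := if (k : ℕ) < i ∧ (i : ℕ) ≤ l then k.castSucc else i
  monotone' i j h := by
    have : (i : ℕ) ≤ j := h
    dsimp only
    rw [Fin.le_def]
    split_ifs <;> simp <;> lia

theorem collapse_apply (k l : Fin (n + 1)) (i : Fin (n + 2)) :
    (collapse k l i : ℕ) = if (k : ℕ) < i ∧ (i : ℕ) ≤ l then (k : ℕ) else i := by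
  change ((if (k : ℕ) < i ∧ (i : ℕ) ≤ l then k.castSucc else i : Fin (n + 2)) : ℕ) = _
  split_ifs <;> rfl

theorem prismFst_collapse {k l : Fin (n + 1)} (h : k < l) :
    (prismFst k).comp (collapse k l) = (prismFst l).comp (collapse k l) := by
  refine OrderHom.ext _ _ (funext fun i => ?_)
  have : (k : ℕ) < l := h
  simp only [OrderHom.comp_coe, Function.comp_apply, prismFst_apply, collapse_apply]
  split_ifs <;> first | rfl | lia

theorem prismSnd_collapse {k l : Fin (n + 1)} (h : k < l) :
    (prismSnd k).comp (collapse k l) = (prismSnd l).comp (collapse k l) := by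
  refine OrderHom.ext _ _ (funext fun i => Fin.ext ?_)
  have : (k : ℕ) < l := h
  simp only [OrderHom.comp_coe, Function.comp_apply, prismSnd_apply, collapse_apply]
  split_ifs <;> first | rfl | lia

section

variable {k l : Fin (n + 1)} {q : stdSimplex ℝ (Fin (n + 1)) × unitInterval}

theorem partialSum_eq_of_mem_prismPiece (hk : q ∈ prismPiece k) (hl : q ∈ prismPiece l)
    {a : ℕ} (ha : (k : ℕ) < a) (ha' : a ≤ l) :
    partialSum q.1 a = q.2 :=
  ((partialSum_mono q.1 ha').trans hl.1).antisymm
    (hk.2.trans (partialSum_mono q.1 (Nat.succ_le_of_lt ha)))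

theorem prismCoord_eq_of_mem (h : k < l) (hk : q ∈ prismPiece k) (hl : q ∈ prismPiece l) :
    prismCoord k q = prismCoord l q := by
  refine stdSimplex_ext_partialSum fun a ha => ?_
  have hlt : (k : ℕ) < l := h
  have e := @partialSum_eq_of_mem_prismPiece _ _ _ _ hk hl
  rw [partialSum_prismCoord _ hk ha, partialSum_prismCoord _ hl ha]
  split_ifs with h1 h2 h3 h4 h5 h6 h7
  all_goals first | rfl | lia | skip
  · exact (e (by lia) (by lia)).symm
  · rw [e (by lia) (by lia), e (by lia) (by lia)]
  · exact e (by lia) (by lia)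

theorem map_collapse_prismCoord (h : k < l) (hk : q ∈ prismPiece k) (hl : q ∈ prismPiece l) :
    stdSimplex.map (collapse k l) (prismCoord k q) = prismCoord k q := by
  refine stdSimplex_ext_partialSum fun a ha => ?_
  have hlt : (k : ℕ) < l := h
  have e := @partialSum_eq_of_mem_prismPiece _ _ _ _ hk hl
  by_cases h1 : (k : ℕ) < a ∧ a ≤ l
  · rw [partialSum_map (a := l + 1) _ _ (fun i => by rw [collapse_apply]; split_ifs <;> lia)]
    rw [prismCoord_eq_of_mem h hk hl, partialSum_prismCoord _ hl ha,
      partialSum_prismCoord _ hl (by lia), if_neg (by lia), if_pos rfl, if_pos h1.2, e h1.1 h1.2]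
  · exact partialSum_map _ _ (fun i => by rw [collapse_apply]; split_ifs <;> lia)

end

end Prism

section Realization

variable {C D : Type u} [Category.{w} C] [Category.{w} D]

/-- The characteristic map of a simplex of the nerve. -/
noncomputable def charMap {m : ℕ} (y : ComposableArrows D m) :
    C(stdSimplex ℝ (Fin (m + 1)), SSet.toTop.obj (nerve D)) :=
  TopCat.toSSetObjEquiv _ (op ⦋m⦌) ((sSetTopAdj.unit.app (nerve D)).app (op ⦋m⦌) y)

theorem toSSetObjEquiv_map (X : TopCat.{u}) {m n : ℕ} (f : Fin (m + 1) →o Fin (n + 1))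
    (y : (TopCat.toSSet.obj X).obj (op ⦋n⦌)) (t : stdSimplex ℝ (Fin (m + 1))) :
    TopCat.toSSetObjEquiv X (op ⦋m⦌)
      ((TopCat.toSSet.obj X).map (SimplexCategory.mkHom f).op y) t =
      TopCat.toSSetObjEquiv X (op ⦋n⦌) y (stdSimplex.map f t) := rfl

theorem charMap_whiskerLeft {m n : ℕ} (f : Fin (m + 1) →o Fin (n + 1)) (y : ComposableArrows D n)
    (t : stdSimplex ℝ (Fin (m + 1))) :
    charMap (y.whiskerLeft f.monotone.functor) t = charMap y (stdSimplex.map f t) := by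
  have := (sSetTopAdj.unit.app (nerve D)).naturality (SimplexCategory.mkHom f).op
  have h := ConcreteCategory.congr_hom this y
  rw [charMap, charMap, ← toSSetObjEquiv_map]
  exact congrArg (fun z => TopCat.toSSetObjEquiv _ (op ⦋m⦌) z t) h

/-- The simplex of the nerve of `D` given by a simplex of the product of `[1]` and `[n]`. -/
def prismArrows (K : Fin 2 × C ⥤ D) {n m : ℕ} (x : ComposableArrows C n)
    (a : Fin (m + 1) →o Fin 2) (b : Fin (m + 1) →o Fin (n + 1)) : ComposableArrows D m :=
  (a.monotone.functor).prod' (b.monotone.functor ⋙ x) ⋙ K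

variable (K : Fin 2 × C ⥤ D)

theorem charMap_prismArrows_map {n m l : ℕ} (x : ComposableArrows C n) (a : Fin (m + 1) →o Fin 2)
    (b : Fin (m + 1) →o Fin (n + 1)) (f : Fin (l + 1) →o Fin (m + 1))
    (t : stdSimplex ℝ (Fin (l + 1))) : charMap (prismArrows K x a b) (stdSimplex.map f t) =
      charMap (prismArrows K x (a.comp f) (b.comp f)) t :=
  (charMap_whiskerLeft f _ t).symm

/-- The homotopy on the simplex `x`. -/
noncomputable def prismHomotopyFun {n : ℕ} (x : ComposableArrows C n)
    (q : stdSimplex ℝ (Fin (n + 1)) × unitInterval) : SSet.toTop.obj (nerve D) :=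
  charMap (prismArrows K x (prismFst (exists_mem_prismPiece q).choose)
    (prismSnd (exists_mem_prismPiece q).choose))
    (prismCoord (exists_mem_prismPiece q).choose q)

theorem prismHomotopyFun_eq {n : ℕ} (x : ComposableArrows C n) {k : Fin (n + 1)}
    {q : stdSimplex ℝ (Fin (n + 1)) × unitInterval} (hk : q ∈ prismPiece k) :
    prismHomotopyFun K x q =
      charMap (prismArrows K x (prismFst k) (prismSnd k)) (prismCoord k q) := by
  have key {k l : Fin (n + 1)} (h : k < l) (hk : q ∈ prismPiece k) (hl : q ∈ prismPiece l) :
      charMap (prismArrows K x (prismFst k) (prismSnd k)) (prismCoord k q) =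
        charMap (prismArrows K x (prismFst l) (prismSnd l)) (prismCoord l q) := by
    rw [← prismCoord_eq_of_mem h hk hl, ← map_collapse_prismCoord h hk hl,
      charMap_prismArrows_map, charMap_prismArrows_map, prismFst_collapse h, prismSnd_collapse h]
  have hl := (exists_mem_prismPiece q).choose_spec
  rw [prismHomotopyFun]
  rcases lt_trichotomy k (exists_mem_prismPiece q).choose with h | h | h
  · exact (key h hk hl).symm
  · rw [← h]
  · exact key h hl hk

theorem continuous_prismHomotopyFun {n : ℕ} (x : ComposableArrows C n) :
    Continuous (prismHomotopyFun K x) := by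
  refine (locallyFinite_of_finite (fun k : Fin (n + 1) => prismPiece k)).continuous
    (Set.eq_univ_of_forall fun q => Set.mem_iUnion.2 (exists_mem_prismPiece q))
    isClosed_prismPiece fun k => ?_
  exact (((charMap _).continuous.comp (continuous_prismCoord k)).continuousOn).congr
    fun q hq => prismHomotopyFun_eq K x hq

theorem prismHomotopyFun_whiskerLeft {m n : ℕ} (f : Fin (m + 1) →o Fin (n + 1))
    (x : ComposableArrows C n) (q : stdSimplex ℝ (Fin (m + 1)) × unitInterval) :
    prismHomotopyFun K (x.whiskerLeft f.monotone.functor) q =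
      prismHomotopyFun K x (stdSimplex.map f q.1, q.2) := by
  obtain ⟨k, hk⟩ := exists_mem_prismPiece q
  rw [prismHomotopyFun_eq K _ hk, prismHomotopyFun_eq K _ (map_mem_prismPiece f hk),
    ← map_prismCoord f hk, charMap_prismArrows_map, prismMap_fst, prismMap_snd]
  rfl

theorem prismHomotopyFun_zero {n : ℕ} (x : ComposableArrows C n) (t : stdSimplex ℝ (Fin (n + 1))) :
    prismHomotopyFun K x (t, 0) =
      charMap (prismArrows K x (OrderHom.const _ 1) OrderHom.id) t := by
  have hk : (t, (0 : unitInterval)) ∈ prismPiece (0 : Fin (n + 1)) :=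
    ⟨(partialSum_zero _).le, partialSum_nonneg _ _⟩
  have h : stdSimplex.map (Fin.succOrderEmb (n + 1)).toOrderHom t = prismCoord 0 (t, 0) := by
    refine stdSimplex_ext_partialSum fun a ha => ?_
    rw [partialSum_prismCoord _ hk ha, partialSum_map (a := a - 1) _ _ (fun i => ?_)]
    · rcases a with _ | _ | a
      · simp
      · simp [partialSum_zero]
      · simp
    · simp; lia
  rw [prismHomotopyFun_eq K x hk, ← h, charMap_prismArrows_map]
  rfl

theorem prismHomotopyFun_one {n : ℕ} (x : ComposableArrows C n) (t : stdSimplex ℝ (Fin (n + 1))) :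
    prismHomotopyFun K x (t, 1) =
      charMap (prismArrows K x (OrderHom.const _ 0) OrderHom.id) t := by
  have hk : (t, (1 : unitInterval)) ∈ prismPiece (Fin.last n) :=
    ⟨partialSum_le_one _ _, (partialSum_of_le _ (by simp)).ge⟩
  have h : stdSimplex.map (Fin.castSuccOrderEmb (n := n + 1)).toOrderHom t =
      prismCoord (Fin.last n) (t, 1) := by
    refine stdSimplex_ext_partialSum fun a ha => ?_
    rw [partialSum_prismCoord _ hk ha, partialSum_map (a := a) _ _ (fun i => ?_)]
    · split_ifs with h1 h2
      · rfl
      · exact partialSum_of_le _ (by simp at h2; lia)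
      · simp at h1 h2; rw [partialSum_of_le _ (by lia), partialSum_of_le _ (by lia)]
    · simp
  have h1 : (prismFst (Fin.last n)).comp (Fin.castSuccOrderEmb (n := n + 1)).toOrderHom =
      OrderHom.const _ 0 := by
    refine OrderHom.ext _ _ (funext fun i => ?_)
    simp [prismFst_apply]
    lia
  have h2 : (prismSnd (Fin.last n)).comp (Fin.castSuccOrderEmb (n := n + 1)).toOrderHom =
      OrderHom.id := by
    refine OrderHom.ext _ _ (funext fun i => Fin.ext ?_)
    simp [prismSnd_apply]
    lia
  rw [prismHomotopyFun_eq K x hk, ← h, charMap_prismArrows_map, h1, h2]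

end Realization

section Realization

variable {C D : Type u} [Category.{w} C] [Category.{w} D] (K : Fin 2 × C ⥤ D)

/-- The homotopy on a simplex, as a map from the simplex to the path space. -/
noncomputable def prismPath {n : ℕ} (x : ComposableArrows C n) :
    C(stdSimplex ℝ (Fin (n + 1)), C(unitInterval, SSet.toTop.obj (nerve D))) :=
  ContinuousMap.curry ⟨prismHomotopyFun K x, continuous_prismHomotopyFun K x⟩

/-- The simplicial map to the singular set of the path space that represents the homotopy. -/
noncomputable def nerveToPaths : nerve C ⟶
    TopCat.toSSet.obj (TopCat.of C(unitInterval, SSet.toTop.obj (nerve D))) where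
  app Δ := ↾fun x => (TopCat.toSSetObjEquiv _ Δ).symm (prismPath K x)
  naturality Δ Δ' f := by
    ext x
    apply (TopCat.toSSetObjEquiv _ Δ').injective
    refine (Equiv.apply_symm_apply _ _).trans ?_
    refine ContinuousMap.ext fun t => ContinuousMap.ext fun s => ?_
    exact prismHomotopyFun_whiskerLeft K f.unop.toOrderHom x (t, s)

/-- Evaluation of paths. -/
def pathEval (Y : TopCat.{u}) (s : unitInterval) : TopCat.of C(unitInterval, Y) ⟶ Y :=
  TopCat.ofHom ⟨fun γ => γ s, continuous_eval_const s⟩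

theorem nerveToPaths_eval (s : unitInterval) (G : C ⥤ D)
    (h : ∀ {n : ℕ} (x : ComposableArrows C n) (t : stdSimplex ℝ (Fin (n + 1))),
      prismHomotopyFun K x (t, s) = charMap (x ⋙ G) t) :
    nerveToPaths K ≫ TopCat.toSSet.map (pathEval _ s) =
      nerveMap G ≫ sSetTopAdj.unit.app (nerve D) := by
  ext Δ x
  apply (TopCat.toSSetObjEquiv _ Δ).injective
  exact ContinuousMap.ext fun t => h x t

theorem transpose_eval (s : unitInterval) (G : C ⥤ D)
    (h : ∀ {n : ℕ} (x : ComposableArrows C n) (t : stdSimplex ℝ (Fin (n + 1))),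
      prismHomotopyFun K x (t, s) = charMap (x ⋙ G) t) :
    (sSetTopAdj.homEquiv _ _).symm (nerveToPaths K) ≫ pathEval _ s =
      SSet.toTop.map (nerveMap G) := by
  rw [← Adjunction.homEquiv_naturality_right_symm, nerveToPaths_eval K s G h,
    Equiv.symm_apply_eq, Adjunction.homEquiv_unit, Adjunction.unit_naturality]

variable {G H : C ⥤ D}

/-- A natural transformation, as a functor on a product. -/
def cylinderFunctor (α : G ⟶ H) : Fin 2 × C ⥤ D := Functor.uncurry.obj (ComposableArrows.mk₁ α)

theorem prismArrows_zero (α : G ⟶ H) {n : ℕ} (x : ComposableArrows C n) :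
    prismArrows (cylinderFunctor α) x (OrderHom.const _ 0) OrderHom.id = x ⋙ G := by
  refine CategoryTheory.Functor.ext (fun i => rfl) fun i j f => ?_
  change ((ComposableArrows.mk₁ α).map (𝟙 0)).app _ ≫ G.map _ = _
  rw [CategoryTheory.Functor.map_id, NatTrans.id_app]
  exact (Category.id_comp _).trans ((Category.id_comp _).trans (Category.comp_id _)).symm

theorem prismArrows_one (α : G ⟶ H) {n : ℕ} (x : ComposableArrows C n) :
    prismArrows (cylinderFunctor α) x (OrderHom.const _ 1) OrderHom.id = x ⋙ H := by
  refine CategoryTheory.Functor.ext (fun i => rfl) fun i j f => ?_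
  change ((ComposableArrows.mk₁ α).map (𝟙 1)).app _ ≫ H.map _ = _
  rw [CategoryTheory.Functor.map_id, NatTrans.id_app]
  exact (Category.id_comp _).trans ((Category.id_comp _).trans (Category.comp_id _)).symm

/-- A natural transformation induces a homotopy of the induced maps of realizations of nerves. -/
theorem homotopic_nerveRealization (α : G ⟶ H) :
    (nerveRealization G).Homotopic (nerveRealization H) := by
  set Φ := (sSetTopAdj.homEquiv _ _).symm (nerveToPaths (cylinderFunctor α))
  have h0 : Φ ≫ pathEval _ 0 = SSet.toTop.map (nerveMap H) :=
    transpose_eval _ 0 H fun x t => by rw [prismHomotopyFun_zero, prismArrows_one]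
  have h1 : Φ ≫ pathEval _ 1 = SSet.toTop.map (nerveMap G) :=
    transpose_eval _ 1 G fun x t => by rw [prismHomotopyFun_one, prismArrows_zero]
  refine ContinuousMap.Homotopic.symm ⟨⟨⟨fun q => Φ q.2 q.1, ?_⟩, fun x => ?_, fun x => ?_⟩⟩
  · exact (ContinuousMap.continuous_uncurry_of_continuous Φ.hom).comp continuous_swap
  · exact ConcreteCategory.congr_hom h0 x
  · exact ConcreteCategory.congr_hom h1 x

theorem nerveRealization_comp {E : Type u} [Category.{w} E] (G : C ⥤ D) (H : D ⥤ E) :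
    (nerveRealization H).comp (nerveRealization G) = nerveRealization (G ⋙ H) := by
  have : nerveMap (G ⋙ H) = nerveMap G ≫ nerveMap H := rfl
  refine Eq.trans ?_ (congrArg (fun f => (SSet.toTop.map f).hom) this).symm
  rw [CategoryTheory.Functor.map_comp, TopCat.hom_comp]
  rfl

theorem nerveRealization_id : nerveRealization (𝟭 C) = ContinuousMap.id _ := by
  have : nerveMap (𝟭 C) = 𝟙 _ := rfl
  refine (congrArg (fun f => (SSet.toTop.map f).hom) this).trans ?_
  rw [CategoryTheory.Functor.map_id, TopCat.hom_id]

/-- A functor with a strict section `H` and a natural transformation `G ⋙ H ⟶ 𝟭 C` induces a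
homotopy equivalence of nerves. -/
theorem isNerveEquivWithInverse_of_retraction {G : C ⥤ D} {H : D ⥤ C} (α : G ⋙ H ⟶ 𝟭 C)
    (h : H ⋙ G = 𝟭 D) : IsNerveEquivWithInverse G H := by
  constructor
  · rw [nerveRealization_comp, ← nerveRealization_id]
    exact homotopic_nerveRealization α
  · rw [nerveRealization_comp, h, nerveRealization_id]

end Realization

end NerveHomotopy

section GroupTheory

variable {p : ℕ}

theorem isPGroup_of_ker_of_quotient {G : Type*} [Group G] (N : Subgroup G) [N.Normal]
    (hN : IsPGroup p N) (hQ : IsPGroup p (G ⧸ N)) : IsPGroup p G := by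
  rw [isPGroup_iff_pow_pow_eq_one] at *
  intro g
  obtain ⟨a, ha⟩ := hQ g
  rw [← QuotientGroup.mk_pow, QuotientGroup.eq_one_iff] at ha
  obtain ⟨b, hb⟩ := hN ⟨_, ha⟩
  refine ⟨a + b, ?_⟩
  rw [pow_add, pow_mul]
  exact congrArg Subtype.val hb

variable [Fact p.Prime]

theorem isPGroup_prufer_power (k : ℕ) : IsPGroup p (Multiplicative (Fin k → PruferGroup p)) := by
  rw [isPGroup_iff_pow_pow_eq_one]
  intro g
  have h (i : Fin k) : ∃ n : ℕ, p ^ n • (Multiplicative.toAdd g) i = 0 := by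
    obtain ⟨n, hn⟩ := ((Multiplicative.toAdd g) i).2
    refine ⟨n, Subtype.ext ?_⟩
    exact hn
  choose n hn using h
  refine ⟨∑ i, n i, ?_⟩
  apply Multiplicative.toAdd.injective
  funext i
  obtain ⟨c, hc⟩ := pow_dvd_pow p
    (Finset.single_le_sum (f := n) (fun _ _ => Nat.zero_le _) (Finset.mem_univ i))
  rw [toAdd_pow, hc, Pi.smul_apply, mul_comm, mul_smul, hn, smul_zero]
  rfl

/-- A subgroup `H` that does not contain the normal abelian `p`-subgroup `A` with finite quotient a
`p`-group is properly contained in its normalizer. -/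
theorem not_isSelfNormalizing_of_not_le {G : Type*} [Group G] (A : Subgroup G) [A.Normal]
    (hcomm : ∀ x ∈ A, ∀ y ∈ A, x * y = y * x) (hA : IsPGroup p A) [Finite (G ⧸ A)]
    (hQ : IsPGroup p (G ⧸ A)) {H : Subgroup G} (hAH : ¬ A ≤ H) :
    Subgroup.normalizer (H : Set G) ≠ H := by
  intro hH
  have hG := isPGroup_of_ker_of_quotient A hA hQ
  obtain ⟨a, haA, haH⟩ := SetLike.not_le_iff_exists.1 hAH
  set X : Set G := Set.range fun g : G => g * a * g⁻¹ with hX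
  have hXA : X ⊆ A := by
    rintro _ ⟨g, rfl⟩
    exact ‹A.Normal›.conj_mem a haA g
  have hXfin : X.Finite := by
    let f : G ⧸ A → G := Quotient.lift (fun g : G => g * a * g⁻¹) (fun g h hgh => by
      have hgh : g⁻¹ * h ∈ A := QuotientGroup.leftRel_apply.1 hgh
      have := hcomm _ hgh a haA
      have : h * a * h⁻¹ = g * (g⁻¹ * h * a) * h⁻¹ := by group
      simp only [this, hcomm _ hgh a haA]
      group)
    refine (Set.finite_range f).subset ?_
    rintro _ ⟨g, rfl⟩
    exact ⟨(g : G ⧸ A), rfl⟩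
  set M : Subgroup G := Subgroup.closure X with hM
  have hMA : M ≤ A := (Subgroup.closure_le A).2 hXA
  have hMp : IsPGroup p M := hG.to_subgroup M
  have hMfin : Finite M := by
    let _ : CommGroup M :=
      { mul_comm := fun x y => Subtype.ext (hcomm x (hMA x.2) y (hMA y.2)) }
    have : Group.FG M := by
      rw [Group.fg_iff_subgroup_fg]
      exact ⟨hXfin.toFinset, by simp [hM]⟩
    exact CommGroup.finite_of_fg_isMulTorsion M fun x =>
      hMp.isOfFinOrder (Fact.out (p := p.Prime)).ne_zero x
  have hMn (g m : G) (hm : m ∈ M) : g * m * g⁻¹ ∈ M := by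
    have : M.map (MulAut.conj g).toMonoidHom ≤ M := by
      rw [hM, MonoidHom.map_closure, Subgroup.closure_le]
      rintro _ ⟨_, ⟨h, rfl⟩, rfl⟩
      exact Subgroup.subset_closure ⟨g * h, by simp [mul_assoc]⟩
    exact this ⟨m, hm, rfl⟩
  let Y : SubMulAction H (G ⧸ H) :=
    { carrier := MulAction.orbit M ((1 : G) : G ⧸ H)
      smul_mem' := by
        rintro h _ ⟨m, rfl⟩
        refine ⟨⟨h * m * h⁻¹, hMn h m m.2⟩, ?_⟩
        change ((h * m * h⁻¹ * 1 : G) : G ⧸ H) = ((h * (m * 1) : G) : G ⧸ H)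
        rw [QuotientGroup.eq]
        simp [mul_assoc] }
  have hYfin : Finite Y := Set.finite_range _
  let y₀ : Y := ⟨((1 : G) : G ⧸ H), MulAction.mem_orbit_self _⟩
  have haM : a ∈ M := Subgroup.subset_closure ⟨1, by simp⟩
  let y₁ : Y := ⟨((a * 1 : G) : G ⧸ H), ⟨⟨a, haM⟩, rfl⟩⟩
  have hne : y₀ ≠ y₁ := by
    intro h
    have := congrArg Subtype.val h
    rw [QuotientGroup.eq] at this
    simp at this
    exact haH this
  have hdvd : p ∣ Nat.card Y := by
    obtain ⟨n, hn⟩ := hMp.card_orbit ((1 : G) : G ⧸ H)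
    have hn : Nat.card Y = p ^ n := hn
    have : Nontrivial Y := ⟨y₀, y₁, hne⟩
    have := Finite.one_lt_card (α := Y)
    rw [hn] at this ⊢
    refine dvd_pow_self p ?_
    rintro rfl
    simp at this
  have hfix : y₀ ∈ MulAction.fixedPoints H Y := by
    intro h
    refine Subtype.ext ?_
    change ((h * 1 : G) : G ⧸ H) = ((1 : G) : G ⧸ H)
    rw [QuotientGroup.eq]
    simp
  obtain ⟨⟨_, ⟨m, rfl⟩⟩, hy, hy'⟩ :=
    (hG.to_subgroup H).exists_fixed_point_of_prime_dvd_card_of_fixed_point Y hdvd hfix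
  have hconj (h : G) (hh : h ∈ H) : (m : G)⁻¹ * h * m ∈ H := by
    have : ((h * (m * 1) : G) : G ⧸ H) = ((m * 1 : G) : G ⧸ H) :=
      congrArg Subtype.val (hy ⟨h, hh⟩)
    rw [QuotientGroup.eq] at this
    have := H.inv_mem this
    simpa [mul_assoc] using this
  have hmH : (m : G) ∈ Subgroup.normalizer (H : Set G) := by
    rw [Subgroup.mem_normalizer_iff]
    refine fun h => ⟨fun hh => ?_, fun hh => ?_⟩
    · have h1 : h⁻¹ * ((m : G)⁻¹ * h * m) ∈ H := H.mul_mem (H.inv_mem hh) (hconj h hh)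
      have h2 : h⁻¹ * ((m : G)⁻¹ * h * m) ∈ A := by
        have := A.mul_mem (‹A.Normal›.conj_mem _ (A.inv_mem (hMA m.2)) h⁻¹) (hMA m.2)
        simpa [mul_assoc] using this
      have h3 := hcomm _ h2 _ (hMA m.2)
      have : (m : G) * h * (m : G)⁻¹ = h * (h⁻¹ * ((m : G)⁻¹ * h * m))⁻¹ := by
        have e : (m : G) * h * (m : G)⁻¹ * (h⁻¹ * ((m : G)⁻¹ * h * m)) =
            (m : G) * h * (m : G)⁻¹ * (h⁻¹ * ((m : G)⁻¹ * h * m) * m) * (m : G)⁻¹ := by group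
        rw [eq_mul_inv_iff_mul_eq, e, h3]
        group
      rw [this]
      exact H.mul_mem hh (H.inv_mem h1)
    · have := hconj _ hh
      simpa [mul_assoc] using this
  rw [hH] at hmH
  refine hy' (Subtype.ext ?_)
  change ((1 : G) : G ⧸ H) = ((m * 1 : G) : G ⧸ H)
  rw [QuotientGroup.eq]
  simpa using hmH

/-- A group with a normal abelian `p`-subgroup whose quotient is a finite `p`-group satisfies the
normalizer condition. -/
theorem normalizerCondition_of_finite_quotient {G : Type*} [Group G] (A : Subgroup G) [A.Normal]
    (hcomm : ∀ x ∈ A, ∀ y ∈ A, x * y = y * x) (hA : IsPGroup p A) [Finite (G ⧸ A)]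
    (hQ : IsPGroup p (G ⧸ A)) : NormalizerCondition G := by
  rw [normalizerCondition_iff_only_full_group_self_normalizing]
  intro H hH
  by_cases hAH : A ≤ H
  · have : Group.IsNilpotent (G ⧸ A) := hQ.isNilpotent
    have hn := Group.normalizerCondition_of_isNilpotent (G := G ⧸ A)
    rw [normalizerCondition_iff_only_full_group_self_normalizing] at hn
    have hs := QuotientGroup.mk'_surjective A
    have hc : (H.map (QuotientGroup.mk' A)).comap (QuotientGroup.mk' A) = H :=
      Subgroup.comap_map_eq_self (by rwa [QuotientGroup.ker_mk'])
    have := hn (H.map (QuotientGroup.mk' A)) (by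
      apply Subgroup.comap_injective hs
      rw [Subgroup.comap_normalizer_eq_of_surjective _ hs, hc, hH])
    rw [← hc, this, Subgroup.comap_top]
  · exact (not_isSelfNormalizing_of_not_le A hcomm hA hQ hAH hH).elim

/-- Discrete `p`-toral groups are `p`-groups. -/
theorem IsDiscretePToral.isPGroup {S : Type u} [Group S] (h : IsDiscretePToral p S) :
    IsPGroup p S := by
  obtain ⟨k, c, T, hT, ⟨e⟩, -, hp, -⟩ := h
  exact isPGroup_of_ker_of_quotient T ((isPGroup_prufer_power k).of_equiv e.symm) hp

/-- In a discrete `p`-toral group, normalizers of proper subgroups grow. -/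
theorem IsDiscretePToral.eq_of_normalizer_inf_le {S : Type u} [Group S] (h : IsDiscretePToral p S)
    {P Q : Subgroup S} (hPQ : P ≤ Q) (hn : normS P ⊓ Q ≤ P) : P = Q := by
  obtain ⟨k, c, T, hT, ⟨e⟩, hfin, hp, -⟩ := h
  have hinj : Function.Injective (QuotientGroup.map (T.subgroupOf Q) T Q.subtype le_rfl) := by
    rw [injective_iff_map_eq_one]
    intro x
    induction x using QuotientGroup.induction_on with
    | H x =>
      intro hx
      exact (QuotientGroup.eq_one_iff _).2 ((QuotientGroup.eq_one_iff (x : S)).1 hx)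
  have : Finite (Q ⧸ T.subgroupOf Q) := Finite.of_injective _ hinj
  have hN : NormalizerCondition Q := by
    refine normalizerCondition_of_finite_quotient (p := p) (T.subgroupOf Q) ?_ ?_
      (hp.of_injective _ hinj)
    · intro x hx y hy
      have : (⟨x, hx⟩ : T) * ⟨y, hy⟩ = ⟨y, hy⟩ * ⟨x, hx⟩ :=
        e.injective (by rw [map_mul, map_mul, mul_comm])
      exact Subtype.ext (show (x : S) * y = y * x from Subtype.ext_iff.1 this)
    · have hT := (isPGroup_prufer_power (p := p) k).of_equiv e.symm
      exact hT.comap_subtype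
  rw [normalizerCondition_iff_only_full_group_self_normalizing] at hN
  have := hN (P.subgroupOf Q) (le_antisymm (fun x hx => ?_) Subgroup.le_normalizer)
  · exact le_antisymm hPQ (Subgroup.subgroupOf_eq_top.1 this)
  · refine hn ⟨?_, x.2⟩
    rw [Subgroup.mem_normalizer_iff] at hx
    refine Subgroup.mem_normalizer_iff.2 fun y => ?_
    refine ⟨fun hy => (hx ⟨y, hPQ hy⟩).1 hy, fun hy => ?_⟩
    have hyQ : y ∈ Q := by
      have := Q.mul_mem (Q.mul_mem (Q.inv_mem x.2) (hPQ hy)) x.2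
      simpa [mul_assoc] using this
    exact (hx ⟨y, hyQ⟩).2 hy

end GroupTheory

section Images

variable {S : Type u} [Group S]

theorem imageOf_comp {P Q R : Subgroup S} (φ : P →* Q) (ψ : Q →* R) :
    imageOf (ψ.comp φ) = imageOn ψ (imageOf φ) := by
  ext y
  constructor
  · rintro ⟨x, rfl⟩
    exact ⟨φ x, ⟨x, rfl⟩, rfl⟩
  · rintro ⟨z, ⟨x, hx⟩, rfl⟩
    exact ⟨x, congrArg (fun z => ((ψ z : R) : S)) (Subtype.ext hx)⟩

theorem imageOf_inclusion {P Q : Subgroup S} (h : P ≤ Q) : imageOf (Subgroup.inclusion h) = P := by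
  ext y
  exact ⟨by rintro ⟨x, rfl⟩; exact x.2, fun hy => ⟨⟨y, hy⟩, rfl⟩⟩

theorem imageOn_self {P Q : Subgroup S} (φ : P →* Q) : imageOn φ P = imageOf φ := by
  ext y
  exact ⟨by rintro ⟨x, -, rfl⟩; exact ⟨x, rfl⟩, by rintro ⟨x, rfl⟩; exact ⟨x, x.2, rfl⟩⟩

theorem imageOf_le {P Q : Subgroup S} (φ : P →* Q) : imageOf φ ≤ Q := by
  rintro _ ⟨x, rfl⟩
  exact (φ x).2

theorem imageOn_le {P Q : Subgroup S} (φ : P →* Q) (A : Subgroup S) : imageOn φ A ≤ Q := by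
  rintro _ ⟨x, -, rfl⟩
  exact (φ x).2

theorem imageOn_mono {P Q A B : Subgroup S} (φ : P →* Q) (h : A ≤ B) :
    imageOn φ A ≤ imageOn φ B := by
  rintro _ ⟨x, hx, rfl⟩
  exact ⟨x, h hx, rfl⟩

theorem imageOn_inclusion {P Q A : Subgroup S} (h : P ≤ Q) (hA : A ≤ P) :
    imageOn (Subgroup.inclusion h) A = A := by
  ext y
  exact ⟨by rintro ⟨x, hx, rfl⟩; exact hx, fun hy => ⟨⟨y, hA hy⟩, hy, rfl⟩⟩

theorem imageOn_injective {P Q A B : Subgroup S} {φ : P →* Q} (hφ : Function.Injective φ)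
    (hA : A ≤ P) (hB : B ≤ P) (h : imageOn φ A = imageOn φ B) : A = B := by
  have key {A B : Subgroup S} (hA : A ≤ P) (h : imageOn φ A ≤ imageOn φ B) : A ≤ B := by
    intro x hx
    obtain ⟨y, hy, hxy⟩ := h ⟨⟨x, hA hx⟩, hx, rfl⟩
    have : y = ⟨x, hA hx⟩ := hφ (Subtype.ext hxy)
    rw [this] at hy
    exact hy
  exact le_antisymm (key hA h.le) (key hB h.ge)

theorem imageOn_normS {P Q : Subgroup S} (φ : P →* Q) (A : Subgroup S) :
    imageOn φ (normS A) ≤ normS (imageOn φ A) := by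
  have key {x : P} (hx : (x : S) ∈ normS A) {y : S} (hy : y ∈ imageOn φ A) :
      (φ x : S) * y * (φ x : S)⁻¹ ∈ imageOn φ A := by
    obtain ⟨z, hz, rfl⟩ := hy
    exact ⟨x * z * x⁻¹, (Subgroup.mem_normalizer_iff.1 hx z).1 hz, by simp⟩
  rintro _ ⟨x, hx, rfl⟩
  refine Subgroup.mem_normalizer_iff.2 fun y => ⟨key hx, fun hy => ?_⟩
  have := key (x := x⁻¹) (inv_mem hx) hy
  simpa [mul_assoc] using this

end Images

namespace FusionSystem

variable {S : Type u} [Group S] (F : FusionSystem S)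

variable {F} in
/-- A homomorphism `χ` with `ψ ∘ χ = φ` for morphisms `φ`, `ψ` of the fusion system with the image
of `φ` contained in that of `ψ`. -/
theorem exists_lift {P Q R : Subgroup S} {φ : P →* R} {ψ : Q →* R} (hφ : φ ∈ F.Hom P R)
    (hψ : ψ ∈ F.Hom Q R) (h : imageOf φ ≤ imageOf ψ) : ∃ χ ∈ F.Hom P Q, ψ.comp χ = φ := by
  obtain ⟨A, hA, e, he, he', rfl⟩ := F.factor hφ
  obtain ⟨B, hB, f, hf, hf', rfl⟩ := F.factor hψ
  have hAB : A ≤ B := by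
    intro x hx
    obtain ⟨z, hz⟩ := h ⟨e.symm ⟨x, hx⟩, rfl⟩
    have : ((f z : B) : S) = x := by simpa using hz
    rw [← this]
    exact (f z).2
  refine ⟨f.symm.toMonoidHom.comp ((Subgroup.inclusion hAB).comp e.toMonoidHom),
    F.comp_mem (F.comp_mem he (F.inclusion_mem hAB)) hf', ?_⟩
  ext x
  simp

variable {F} in
theorem IsConj.symm {P Q : Subgroup S} (h : F.IsConj P Q) : F.IsConj Q P := by
  obtain ⟨e, he, he'⟩ := h
  exact ⟨e.symm, he', he⟩

end FusionSystem

namespace CentricLinkingSystem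

variable {S : Type u} [Group S] {F : FusionSystem S} {L : CentricLinkingSystem.{u, w} F}

theorem Obj.ext' {P Q : L.Obj} (h : P.grp = Q.grp) : P = Q := FusionSystem.CentricSubgroup.ext h

theorem proj_injective {P Q : L.Obj} (f : P ⟶ Q) : Function.Injective (proj f) :=
  F.injective (proj_mem f)

/-- The image of a morphism of `L`, as a subgroup of `S`. -/
abbrev im {P Q : L.Obj} (f : P ⟶ Q) : Subgroup S := imageOf (proj f)

theorem exists_proj_eq {P Q : L.Obj} {φ : P.grp →* Q.grp} (h : φ ∈ F.Hom P.grp Q.grp) :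
    ∃ f : P ⟶ Q, proj f = φ := L.π_surj φ h

/-- The distinguished monomorphism `P → Aut P`. -/
def delta (P : L.Obj) : P.grp →* Aut P := L.δ P

theorem eq_delta_comp {P Q : L.Obj} {f g : P ⟶ Q} (h : proj f = proj g) :
    ∃ z ∈ Subgroup.center P.grp, g = (delta P z).hom ≫ f := (L.π_eq_iff f g).1 h

theorem eq_one_of_delta_comp {P Q : L.Obj} (f : P ⟶ Q) {z : P.grp}
    (hz : z ∈ Subgroup.center P.grp) (h : (delta P z).hom ≫ f = f) : z = 1 := L.free f z hz h

instance mono {P Q : L.Obj} (g : P ⟶ Q) : Mono g where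
  right_cancellation {R} f f' h := by
    have hp : proj f = proj f' := by
      have := congrArg proj h
      rw [proj_comp, proj_comp] at this
      ext x
      exact congrArg Subtype.val (proj_injective g (DFunLike.congr_fun this x))
    obtain ⟨z, hz, rfl⟩ := eq_delta_comp hp
    rw [Category.assoc] at h
    have hz1 : z = 1 := eq_one_of_delta_comp (f ≫ g) hz h.symm
    have : (delta R z).hom = 𝟙 R := by rw [hz1, map_one]; rfl
    rw [this, Category.id_comp]

theorem im_comp {P Q R : L.Obj} (f : P ⟶ Q) (g : Q ⟶ R) :
    im (f ≫ g) = imageOn (proj g) (im f) := by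
  rw [im, proj_comp, imageOf_comp]

theorem im_comp_le {P Q R : L.Obj} (f : P ⟶ Q) (g : Q ⟶ R) : im (f ≫ g) ≤ im g := by
  rw [im_comp, im, im, ← imageOn_self (proj g)]
  exact imageOn_mono _ (imageOf_le _)

theorem im_id (P : L.Obj) : im (𝟙 P) = P.grp := by
  rw [im, proj_id]
  exact imageOf_inclusion le_rfl

theorem im_of_isIso {P Q : L.Obj} (f : P ⟶ Q) [IsIso f] : im f = Q.grp := by
  refine le_antisymm (imageOf_le _) ?_
  have := im_comp_le (inv f) f
  rwa [IsIso.inv_hom_id, im_id] at this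

/-- A morphism `f` of `L` factors through `g` if the image of `f` is contained in that of `g`. -/
theorem exists_lift {P Q R : L.Obj} (f : P ⟶ R) (g : Q ⟶ R) (h : im f ≤ im g) :
    ∃ k : P ⟶ Q, k ≫ g = f := by
  obtain ⟨χ, hχ, hχ'⟩ := FusionSystem.exists_lift (proj_mem f) (proj_mem g) h
  obtain ⟨k, rfl⟩ := exists_proj_eq hχ
  obtain ⟨z, -, rfl⟩ := eq_delta_comp (f := k ≫ g) (g := f) (by rw [proj_comp, hχ'])
  exact ⟨(delta P z).hom ≫ k, Category.assoc _ _ _⟩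

theorem exists_iso {P Q R : L.Obj} (f : P ⟶ R) (g : Q ⟶ R) (h : im f = im g) :
    ∃ k : P ≅ Q, k.hom ≫ g = f := by
  obtain ⟨k, hk⟩ := exists_lift f g h.le
  obtain ⟨l, hl⟩ := exists_lift g f h.ge
  refine ⟨⟨k, l, ?_, ?_⟩, hk⟩
  · rw [← cancel_mono f, Category.assoc, hl, hk, Category.id_comp]
  · rw [← cancel_mono g, Category.assoc, hk, hl, Category.id_comp]

theorem isIso_of_im_eq {P Q : L.Obj} (f : P ⟶ Q) (h : im f = Q.grp) : IsIso f := by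
  obtain ⟨k, hk⟩ := exists_iso f (𝟙 Q) (by rw [h, im_id])
  rw [← hk, Category.comp_id]
  infer_instance

namespace Inclusions

variable (I : L.Inclusions)

theorem im_ι {P Q : L.Obj} (h : P.grp ≤ Q.grp) : im (I.ι h) = P.grp := by
  rw [im, I.proj_ι, imageOf_inclusion]

theorem ι_eq_eqToHom {P Q : L.Obj} (h : P = Q) : I.ι (congrArg Obj.grp h).le = eqToHom h := by
  subst h
  exact I.ι_refl P

theorem im_ι_comp {P Q R : L.Obj} (h : P.grp ≤ Q.grp) (f : Q ⟶ R) :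
    im (I.ι h ≫ f) = imageOn (proj f) P.grp := by
  rw [im_comp, im_ι]

end Inclusions

theorem exists_lift_inclusion {P Q : L.Obj} (h : P.grp ≤ Q.grp) :
    ∃ f : P ⟶ Q, proj f = Subgroup.inclusion h := exists_proj_eq (F.inclusion_mem h)

/-- Compatible lifts of inclusions exist, as soon as `L` has an object. -/
theorem nonempty_inclusions (P₀ : L.Obj) : Nonempty L.Inclusions := by
  let T : L.Obj := P₀.over ⊤ le_top
  have hT (P : L.Obj) : P.grp ≤ T.grp := le_top
  choose t ht using fun P : L.Obj => exists_lift_inclusion (hT P)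
  have him (P : L.Obj) : im (t P) = P.grp := by rw [im, ht, imageOf_inclusion]
  have h2 {P Q : L.Obj} (h : P.grp ≤ Q.grp) : ∃ f : P ⟶ Q, f ≫ t Q = t P :=
    exists_lift _ _ (by rwa [him, him])
  choose f hf using @h2
  refine ⟨⟨@f, fun {P Q} h => ?_, fun P => ?_, fun {P Q R} h h' => ?_⟩⟩
  · ext x
    have := congrArg proj (hf h)
    rw [proj_comp, ht, ht] at this
    exact congrArg (fun y : T.grp => (y : S)) (DFunLike.congr_fun this x)
  · rw [← cancel_mono (t P), hf, Category.id_comp]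
  · rw [← cancel_mono (t R), Category.assoc, hf, hf, hf]

end CentricLinkingSystem

section Images

variable {S : Type u} [Group S]

theorem innAut_le_autS (P : Subgroup S) : innAut P ≤ autS P := by
  rintro _ ⟨x, rfl⟩
  exact ⟨x, le_normS P x.2, fun y => rfl⟩

theorem isPGroup_autS {p : ℕ} (hS : IsPGroup p S) (P : Subgroup S) : IsPGroup p (autS P) := by
  rw [isPGroup_iff_pow_pow_eq_one] at *
  rintro ⟨α, g, hg, hα⟩
  obtain ⟨n, hn⟩ := hS g
  refine ⟨n, Subtype.ext (MulEquiv.ext fun x => Subtype.ext ?_)⟩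
  have key (m : ℕ) (x : P) : (((α ^ m) x : P) : S) = g ^ m * x * (g ^ m)⁻¹ := by
    induction m generalizing x with
    | zero => simp
    | succ m ih => rw [pow_succ, MulAut.mul_apply, ih, hα]; simp [pow_succ, mul_assoc]
  change (((α ^ p ^ n) x : P) : S) = x
  rw [key, hn]
  simp

end Images

namespace FusionSystem

variable {p : ℕ} [Fact p.Prime] {S : Type u} [Group S] {F : FusionSystem S}

theorem mem_autS_of_mk_mem_outS {P : Subgroup S} {b : F.aut P}
    (hb : QuotientGroup.mk' ((innAut P).subgroupOf (F.aut P)) b ∈ F.outS P) :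
    (b : MulAut P) ∈ autS P := by
  obtain ⟨c, hc, hcb⟩ := hb
  have h : c⁻¹ * b ∈ (innAut P).subgroupOf (F.aut P) := QuotientGroup.eq.1 hcb
  have h' : (c : MulAut P)⁻¹ * b ∈ autS P := innAut_le_autS P h
  have := (autS P).mul_mem (show (c : MulAut P) ∈ autS P from hc) h'
  simpa using this

/-- A `p`-subgroup of `Aut_F(P)`, for `P` fully normalized, is conjugate to a subgroup of
`Aut_S(P)`. -/
theorem IsSaturated.exists_conj_mem_autS (hF : F.IsSaturated p) {P : Subgroup S}
    (hP : F.IsFullyNormalized p P) {K : Subgroup (F.aut P)} (hK : IsPGroup p K) :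
    ∃ a : F.aut P, ∀ k ∈ K, ((a * k * a⁻¹ : F.aut P) : MulAut P) ∈ autS P := by
  obtain ⟨-, hfin, T, hT⟩ := hF.sylow P hP
  obtain ⟨U, hU⟩ := (hK.map (QuotientGroup.mk' ((innAut P).subgroupOf (F.aut P)))).exists_le_sylow
  obtain ⟨g, hg⟩ := MulAction.exists_smul_eq (F.Out P) U T
  obtain ⟨a, rfl⟩ := QuotientGroup.mk'_surjective _ g
  refine ⟨a, fun k hk => mem_autS_of_mk_mem_outS ?_⟩
  rw [← hT, ← hg, map_mul, map_mul, map_inv]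
  exact ⟨_, hU ⟨k, hk, rfl⟩, rfl⟩

/-- If `P` is fully normalized and `Q` is conjugate to `P`, then there is a morphism
`N_S Q → N_S P` that maps `Q` onto `P`. -/
theorem IsSaturated.exists_normalizer_hom (hF : F.IsSaturated p) (hS : IsPGroup p S)
    {P Q : Subgroup S} (hP : F.IsFullyNormalized p P) (h : F.IsConj Q P) :
    ∃ ψ ∈ F.Hom (normS Q) (normS P), imageOn ψ Q = P := by
  obtain ⟨e, he, he'⟩ := h
  have hmem (α : MulAut Q) (hα : α ∈ autS Q) : MulAut.congr e α ∈ F.aut P := by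
    have key (α : MulAut Q) (hα : α ∈ autS Q) : (MulAut.congr e α).toMonoidHom ∈ F.Hom P P := by
      obtain ⟨g, hg, hgα⟩ := hα
      have hc : α.toMonoidHom ∈ F.Hom Q Q := by
        convert F.conj_mem g (fun x hx => (Subgroup.mem_normalizer_iff.1 hg x).1 hx) using 1
        ext x
        exact hgα x
      exact F.comp_mem (F.comp_mem he' hc) he
    refine ⟨key α hα, ?_⟩
    have := key α⁻¹ (inv_mem hα)
    rwa [map_inv] at this
  let f : autS Q →* F.aut P :=
    ((MulAut.congr e).toMonoidHom.comp (autS Q).subtype).codRestrict _ fun α => hmem α α.2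
  obtain ⟨a, ha⟩ := hF.exists_conj_mem_autS hP
    ((isPGroup_autS hS Q).of_surjective f.rangeRestrict f.rangeRestrict_surjective)
  let φ : Q →* (⊤ : Subgroup S) :=
    (Subgroup.inclusion le_top).comp ((a : MulAut P).toMonoidHom.comp e.toMonoidHom)
  have hφ : φ ∈ F.Hom Q ⊤ := F.comp_mem (F.comp_mem he a.2.1) (F.inclusion_mem le_top)
  have hφv (x : Q) : (φ x : S) = (a : MulAut P) (e x) := rfl
  have him : imageOf φ = P := by
    ext y
    refine ⟨?_, fun hy => ⟨e.symm ((a : MulAut P)⁻¹ ⟨y, hy⟩), ?_⟩⟩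
    · rintro ⟨x, rfl⟩
      exact ((a : MulAut P) (e x)).2
    · change ((φ _ : (⊤ : Subgroup S)) : S) = y
      rw [hφv]
      simp
  have hdom : normS Q ≤ extDomain φ := by
    intro g hg
    let α : MulAut Q := Subgroup.normalizerMonoidHom Q ⟨g, hg⟩
    have hα (x : Q) : α x = ⟨g * x * g⁻¹, (Subgroup.mem_normalizer_iff.1 hg x).1 x.2⟩ := rfl
    have hαS : α ∈ autS Q := ⟨g, hg, fun x => rfl⟩
    obtain ⟨h, hh, hhx⟩ := ha (f ⟨α, hαS⟩) ⟨_, rfl⟩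
    refine ⟨hg, h, by rwa [him], fun x => ?_⟩
    rw [← hα, hφv, hφv, ← hhx]
    simp [f]
  obtain ⟨ψ, hψ, hψφ⟩ := hF.extend Q φ hφ (by rw [him]; exact (hF.sylow P hP).1)
  set ψ' := ψ.comp (Subgroup.inclusion hdom) with hψ'
  have hval (x : normS Q) (hx : (x : S) ∈ Q) : (ψ' x : S) = φ ⟨x, hx⟩ := by
    rw [← hψφ]
    rfl
  have himQ : imageOn ψ' Q = P := by
    rw [← him]
    ext y
    constructor
    · rintro ⟨x, hx, rfl⟩
      exact ⟨⟨x, hx⟩, (hval x hx).symm⟩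
    · rintro ⟨x, rfl⟩
      exact ⟨⟨x, le_normS Q x.2⟩, x.2, hval _ _⟩
  obtain ⟨χ, hχ, hχψ⟩ := FusionSystem.exists_lift
    (F.comp_mem (F.inclusion_mem hdom) hψ) (F.inclusion_mem (le_top (a := normS P))) (by
      rw [imageOf_inclusion, ← imageOn_self]
      exact (imageOn_normS ψ' Q).trans (by rw [himQ]))
  refine ⟨χ, hχ, Eq.trans ?_ himQ⟩
  rw [hψ', ← hχψ]
  rfl

end FusionSystem

namespace CentricLinkingSystem

variable {p : ℕ} [Fact p.Prime] {S : Type u} [Group S] {F : FusionSystem S}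
  {L : CentricLinkingSystem.{u, w} F}

theorem nonempty_retractionChoice (hF : F.IsSaturated p) (hS : IsPGroup p S) {P : L.Obj}
    (hP : F.IsFullyNormalized p P.grp) : Nonempty (RetractionChoice P) := by
  classical
  have key (φ : Under P) : ∃ f : (imageObj φ.hom).norm ⟶ P.norm,
      imageOn (proj f) (imageObj φ.hom).grp = P.grp ∧
      ∀ h : imageObj φ.hom = P, f = eqToHom (congrArg Obj.norm h) := by
    have key' (A : L.Obj) (hA : F.IsConj A.grp P.grp) : ∃ f : A.norm ⟶ P.norm,
        imageOn (proj f) A.grp = P.grp ∧ ∀ h : A = P, f = eqToHom (congrArg Obj.norm h) := by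
      by_cases h : A = P
      · subst h
        exact ⟨𝟙 _, by rw [proj_id]; exact FusionSystem.imageOn_id (le_normS _), fun _ => rfl⟩
      · obtain ⟨ψ, hψ, hψP⟩ := hF.exists_normalizer_hom hS hP hA
        obtain ⟨f, rfl⟩ := exists_proj_eq (P := A.norm) (Q := P.norm) hψ
        exact ⟨f, hψP, fun h' => (h h').elim⟩
    exact key' _ (FusionSystem.isConj_imageOf (proj_mem φ.hom)).symm
  choose f hf hf' using key
  exact ⟨⟨f, hf, hf'⟩⟩

end CentricLinkingSystem

namespace CentricLinkingSystem

variable {S : Type u} [Group S] {F : FusionSystem S} {L : CentricLinkingSystem.{u, w} F}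

theorem im_iso_comp {P Q R : L.Obj} (f : P ⟶ Q) [IsIso f] (g : Q ⟶ R) : im (f ≫ g) = im g := by
  rw [im_comp, im_of_isIso, imageOn_self]

theorem imageOn_proj_of_eq {Q R : L.Obj} (f : Q ⟶ R) {A : Subgroup S} (h : Q.grp = A) :
    imageOn (proj f) A = im f := by
  subst h
  exact imageOn_self _

theorem le_norm_grp (P : L.Obj) : P.grp ≤ P.norm.grp := le_normS P.grp

theorem normInObj_le_norm {P Q : L.Obj} (φ : P ⟶ Q) :
    (normInObj φ).grp ≤ (imageObj φ).norm.grp := inf_le_left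

theorem normInObj_le {P Q : L.Obj} (φ : P ⟶ Q) : (normInObj φ).grp ≤ Q.grp := inf_le_right

theorem imageObj_le_normInObj {P Q : L.Obj} (φ : P ⟶ Q) :
    (imageObj φ).grp ≤ (normInObj φ).grp := le_inf (le_normS _) (imageObj_le _)

variable {P : L.Obj}

theorem le_right_grp (σ : NormUnder P) : P.grp ≤ σ.right.grp := by
  intro x hx
  obtain ⟨⟨ψ, -, h1⟩, h2⟩ := σ.hom.2
  obtain ⟨y, hy, hyx⟩ := h2.ge hx
  have := h1 ⟨y, hy⟩
  rw [← hyx]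
  exact (congrArg (· ∈ σ.right.grp) this).mpr (ψ _).2

theorem NormObj.prod_grp {Q : NormObj P} (h : P.grp ≤ Q.grp) : Q.prod.grp = Q.grp :=
  sup_eq_left.2 h

theorem inNorm_prod_grp (P : L.Obj) : P.inNorm.prod.grp = P.grp := sup_idem P.grp

theorem im_underIncl_hom (σ : NormUnder P) : im ((underIncl P).obj σ).hom = P.grp := by
  change im (eqToHom P.eq_prod ≫ σ.hom.1) = P.grp
  rw [im_iso_comp, ← imageOn_proj_of_eq _ (inNorm_prod_grp P)]
  exact σ.hom.2.2

theorem isNormMor_of_imageOn_eq {Q R : NormObj P} (hR : P.grp ≤ R.grp) {φ : Q.prod ⟶ R.prod}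
    (h : imageOn (proj φ) P.grp = P.grp) : IsNormMor Q R φ :=
  ⟨⟨(Subgroup.inclusion (NormObj.prod_grp hR).le).comp
      ((proj φ).comp (Subgroup.inclusion Q.grp_le_prod)),
    ⟨F.comp_mem (F.comp_mem (F.inclusion_mem _) (proj_mem φ)) (F.inclusion_mem _),
      proj φ, proj_mem φ, fun _ => rfl, h⟩, fun _ => rfl⟩, h⟩

theorem underIncl_map_injective {σ τ : NormUnder P} {f g : σ ⟶ τ}
    (h : (underIncl P).map f = (underIncl P).map g) : f = g := by
  have h' : f.right.1 = g.right.1 := congrArg (fun k => k.right) h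
  exact Under.UnderMorphism.ext (Subtype.ext h')

theorem exists_underIncl_map_eq {σ τ : NormUnder P}
    (f : (underIncl P).obj σ ⟶ (underIncl P).obj τ) : ∃ g : σ ⟶ τ, (underIncl P).map g = f := by
  have hw : ((underIncl P).obj σ).hom ≫ f.right = ((underIncl P).obj τ).hom := Under.w f
  have him : imageOn (proj f.right) P.grp = P.grp := by
    have := im_comp ((underIncl P).obj σ).hom f.right
    rw [hw, im_underIncl_hom, im_underIncl_hom] at this
    exact this.symm
  let g : σ.right ⟶ τ.right := ⟨f.right, isNormMor_of_imageOn_eq (le_right_grp τ) him⟩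
  refine ⟨Under.homMk g (Subtype.ext ?_), ?_⟩
  · change σ.hom.1 ≫ f.right = τ.hom.1
    have hw' : eqToHom P.eq_prod ≫ σ.hom.1 ≫ f.right = eqToHom P.eq_prod ≫ τ.hom.1 :=
      (Category.assoc _ _ _).symm.trans hw
    exact (cancel_epi _).1 hw'
  · exact Under.UnderMorphism.ext rfl

theorem under_eq_of_right_eq_eqToHom {C : Type*} [Category* C] {A : C} {X Y : Under A} (f : X ⟶ Y)
    (h : X.right = Y.right) (hf : f.right = eqToHom h) : ∃ e : X = Y, f = eqToHom e := by
  have hw := Under.w f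
  rw [hf] at hw
  obtain ⟨⟨⟨⟩⟩, B, x⟩ := X
  obtain ⟨⟨⟨⟩⟩, B', y⟩ := Y
  obtain rfl : B = B' := h
  obtain rfl : x = y := (Category.comp_id x).symm.trans hw
  exact ⟨rfl, Under.UnderMorphism.ext hf⟩

theorem underIncl_obj_injective {σ τ : NormUnder P}
    (h : (underIncl P).obj σ = (underIncl P).obj τ) :
    σ = τ := by
  have hgrp : σ.right.prod.grp = τ.right.prod.grp := congrArg (fun X : Under P => X.right.grp) h
  rw [NormObj.prod_grp (le_right_grp σ), NormObj.prod_grp (le_right_grp τ)] at hgrp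
  obtain ⟨⟨⟨⟩⟩, ⟨A, hA, hA'⟩, x⟩ := σ
  obtain ⟨⟨⟨⟩⟩, ⟨B, hB, hB'⟩, y⟩ := τ
  obtain rfl : A = B := hgrp
  have hxy : eqToHom P.eq_prod ≫ x.1 = eqToHom P.eq_prod ≫ y.1 := by
    exact eq_of_heq (Comma.mk.inj h).2.2
  obtain rfl : x = y := Subtype.ext ((cancel_epi _).1 hxy)
  rfl

variable {I : L.Inclusions} {c : RetractionChoice P}

theorem isRetractionAt_iff {φ : Under P} {ρ : NormUnder P} {η : (underIncl P).obj ρ ⟶ φ} :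
    IsRetractionAt I c φ ρ η ↔ ρ.right.grp = imageOn (proj (c.lift φ)) (normInObj φ.hom).grp ∧
    ∃ (φ₀ : P ⟶ imageObj φ.hom) (F₁ : normInObj φ.hom ≅ ρ.right.prod) (F₂ : imageObj φ.hom ≅ P),
      φ₀ ≫ I.ι (imageObj_le φ.hom) = φ.hom ∧
      F₁.hom ≫ I.ι ρ.right.prod_le = I.ι (normInObj_le_norm φ.hom) ≫ c.lift φ ∧
      F₂.hom ≫ I.ι (le_norm_grp P) = I.ι (le_norm_grp (imageObj φ.hom)) ≫ c.lift φ ∧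
      ((underIncl P).obj ρ).hom = φ₀ ≫ F₂.hom ≫ I.ι ρ.right.le_prod ∧
      η.right = F₁.inv ≫ I.ι (normInObj_le φ.hom) := Iff.rfl

theorem im_right_of_isRetractionAt {φ : Under P} {ρ : NormUnder P}
    {η : (underIncl P).obj ρ ⟶ φ} (h : IsRetractionAt I c φ ρ η) :
    im η.right = (normInObj φ.hom).grp := by
  obtain ⟨-, φ₀, F₁, F₂, -, -, -, -, h⟩ := isRetractionAt_iff.1 h
  exact (congrArg im h).trans ((im_iso_comp F₁.inv _).trans (I.im_ι _))

/-- The value of the retraction at an object exists. -/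
theorem exists_isRetractionAt (I : L.Inclusions) (c : RetractionChoice P) (φ : Under P) :
    ∃ (ρ : NormUnder P) (η : (underIncl P).obj ρ ⟶ φ), IsRetractionAt I c φ ρ η := by
  have hAN := imageObj_le_normInObj φ.hom
  have hPT : P.grp ≤ imageOn (proj (c.lift φ)) (normInObj φ.hom).grp :=
    (c.image_eq φ).ge.trans (imageOn_mono _ hAN)
  let T : NormObj P :=
    { grp := imageOn (proj (c.lift φ)) (normInObj φ.hom).grp
      le_norm := imageOn_le _ _
      centric := FusionSystem.IsCentric.isNormCentric (P.centric.of_le hPT) }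
  have hT : T.prod.grp = imageOn (proj (c.lift φ)) (normInObj φ.hom).grp := NormObj.prod_grp hPT
  obtain ⟨φ₀, h₀⟩ := exists_iso φ.hom (I.ι (imageObj_le φ.hom)) (by rw [I.im_ι]; rfl)
  obtain ⟨F₁, h₁⟩ := exists_iso (I.ι (normInObj_le_norm φ.hom) ≫ c.lift φ) (I.ι T.prod_le)
    (by rw [I.im_ι_comp, I.im_ι, hT])
  obtain ⟨F₂, h₂⟩ := exists_iso (I.ι (le_norm_grp (imageObj φ.hom)) ≫ c.lift φ)
    (I.ι (le_norm_grp P)) (by rw [I.im_ι_comp, I.im_ι, c.image_eq])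
  let k : P ⟶ T.prod := φ₀.hom ≫ F₂.hom ≫ I.ι T.le_prod
  have him : imageOn (proj (eqToHom P.eq_prod.symm ≫ k)) P.grp = P.grp := by
    rw [imageOn_proj_of_eq _ (inNorm_prod_grp P), im_iso_comp, im_iso_comp, im_iso_comp, I.im_ι]
  let g : P.inNorm ⟶ T := ⟨eqToHom P.eq_prod.symm ≫ k, isNormMor_of_imageOn_eq hPT him⟩
  have hg : eqToHom P.eq_prod ≫ g.1 = k := by
    change eqToHom P.eq_prod ≫ eqToHom P.eq_prod.symm ≫ k = _
    rw [← Category.assoc, eqToHom_trans, eqToHom_refl, Category.id_comp]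
  have hkey : F₂.hom ≫ I.ι T.le_prod = I.ι hAN ≫ F₁.hom := by
    rw [← cancel_mono (I.ι T.prod_le), Category.assoc, Category.assoc, I.ι_trans, h₁, h₂,
      ← Category.assoc, I.ι_trans]
  have hw : k ≫ F₁.inv ≫ I.ι (normInObj_le φ.hom) = φ.hom := by
    refine Eq.trans ?_ h₀
    simp only [k, hkey, Category.assoc, Iso.hom_inv_id_assoc, I.ι_trans]
  refine ⟨Under.mk g, Under.homMk (F₁.inv ≫ I.ι (normInObj_le φ.hom)) ?_,
    isRetractionAt_iff.2 ⟨rfl, φ₀.hom, F₁, F₂, h₀, h₁, h₂, hg, rfl⟩⟩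
  exact (congrArg (· ≫ F₁.inv ≫ I.ι (normInObj_le φ.hom)) hg).trans hw

/-- The morphisms `η` of the retraction are universal. -/
theorem exists_lift_of_isRetractionAt {φ : Under P} {ρ : NormUnder P}
    {η : (underIncl P).obj ρ ⟶ φ} (h : IsRetractionAt I c φ ρ η) {σ : NormUnder P}
    (f : (underIncl P).obj σ ⟶ φ) : ∃ g : σ ⟶ ρ, (underIncl P).map g ≫ η = f := by
  have hw : ((underIncl P).obj σ).hom ≫ f.right = φ.hom := Under.w f
  have him : imageOn (proj f.right) P.grp = (imageObj φ.hom).grp := by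
    have := im_comp ((underIncl P).obj σ).hom f.right
    rw [hw, im_underIncl_hom] at this
    exact this.symm
  have hle : im f.right ≤ im η.right := by
    rw [im_right_of_isRetractionAt h]
    refine le_inf ?_ (imageOf_le _)
    rw [← him, im, ← imageOn_self]
    exact (imageOn_mono _ σ.right.prod_le).trans (imageOn_normS _ _)
  obtain ⟨k, hk⟩ := exists_lift f.right η.right hle
  have hkw : ((underIncl P).obj σ).hom ≫ k = ((underIncl P).obj ρ).hom := by
    rw [← cancel_mono η.right, Category.assoc, hk]
    exact hw.trans (Under.w η).symm
  obtain ⟨g, hg⟩ := exists_underIncl_map_eq (Under.homMk k hkw)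
  exact ⟨g, by rw [hg]; exact Under.UnderMorphism.ext hk⟩

theorem eq_of_map_comp_eq {φ : Under P} {σ ρ : NormUnder P} {f g : σ ⟶ ρ}
    (η : (underIncl P).obj ρ ⟶ φ)
    (h : (underIncl P).map f ≫ η = (underIncl P).map g ≫ η) : f = g := by
  refine underIncl_map_injective (Under.UnderMorphism.ext ?_)
  have : ((underIncl P).map f).right ≫ η.right = ((underIncl P).map g).right ≫ η.right :=
    congrArg (fun k => k.right) h
  exact (cancel_mono _).1 this

/-- The retraction exists as a functor with a natural transformation. -/
theorem exists_retraction (I : L.Inclusions) (c : RetractionChoice P) :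
    ∃ (r : Under P ⥤ NormUnder P) (η : r ⋙ underIncl P ⟶ 𝟭 (Under P)),
      ∀ φ : Under P, IsRetractionAt I c φ (r.obj φ) (η.app φ) := by
  choose ρ η h using exists_isRetractionAt I c
  have hmap {φ ψ : Under P} (f : φ ⟶ ψ) :
      ∃ g : ρ φ ⟶ ρ ψ, (underIncl P).map g ≫ η ψ = η φ ≫ f := exists_lift_of_isRetractionAt (h ψ) _
  choose m hm using @hmap
  refine ⟨{ obj := ρ, map := m, map_id := fun φ => ?_, map_comp := fun f g => ?_ },
    { app := η, naturality := fun φ ψ f => hm f }, h⟩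
  · apply eq_of_map_comp_eq (η φ)
    rw [hm, CategoryTheory.Functor.map_id, Category.comp_id, Category.id_comp]
  · apply eq_of_map_comp_eq (η _)
    rw [hm, CategoryTheory.Functor.map_comp, Category.assoc, hm]
    simp only [← Category.assoc, hm]

/-- The retraction is the identity on `P ↓ N_L P`. -/
theorem eq_of_isRetractionAt {σ ρ : NormUnder P}
    {η : (underIncl P).obj ρ ⟶ (underIncl P).obj σ}
    (h : IsRetractionAt I c ((underIncl P).obj σ) ρ η) :
    ∃ e : ρ = σ, (underIncl P).map (eqToHom e) = η := by
  have hA : imageObj ((underIncl P).obj σ).hom = P := Obj.ext' (im_underIncl_hom σ)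
  have hlift : c.lift ((underIncl P).obj σ) = I.ι (congrArg Obj.grp (congrArg Obj.norm hA)).le := by
    rw [c.lift_eq_id _ hA, I.ι_eq_eqToHom (congrArg Obj.norm hA)]
  have hN : (normInObj ((underIncl P).obj σ).hom).grp = σ.right.prod.grp := by
    change normS (imageObj ((underIncl P).obj σ).hom).grp ⊓ σ.right.prod.grp = _
    rw [hA]
    exact inf_eq_right.2 σ.right.prod_le
  obtain ⟨h1, φ₀, F₁, F₂, h₀, h₁, h₂, h2, h3⟩ := isRetractionAt_iff.1 h
  have hρ : ρ.right.prod.grp = σ.right.prod.grp := by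
    rw [NormObj.prod_grp (le_right_grp ρ), h1, hlift, I.proj_ι, imageOn_inclusion, hN]
    exact inf_le_left
  have hη : η.right = I.ι (P := ρ.right.prod) (Q := σ.right.prod) hρ.le := by
    rw [hlift, I.ι_trans] at h₁
    have hF₁ : F₁.hom = I.ι (hN.trans hρ.symm).le := by
      rw [← cancel_mono (I.ι ρ.right.prod_le), h₁, I.ι_trans]
    refine h3.trans ((Iso.inv_comp_eq F₁).2 ?_)
    rw [hF₁]
    exact (I.ι_trans _ _).symm
  have hobj : ρ.right.prod = σ.right.prod := Obj.ext' hρ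
  obtain ⟨e, he⟩ := under_eq_of_right_eq_eqToHom η hobj (hη.trans (I.ι_eq_eqToHom hobj))
  obtain rfl := underIncl_obj_injective e
  exact ⟨rfl, by rw [he]; simp⟩

theorem underIncl_comp_retraction {r : Under P ⥤ NormUnder P}
    {η : r ⋙ underIncl P ⟶ 𝟭 (Under P)}
    (h : ∀ φ : Under P, IsRetractionAt I c φ (r.obj φ) (η.app φ)) :
    underIncl P ⋙ r = 𝟭 (NormUnder P) := by
  choose e he using fun σ => eq_of_isRetractionAt (h ((underIncl P).obj σ))
  refine CategoryTheory.Functor.ext e fun σ τ f => ?_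
  apply eq_of_map_comp_eq (η.app ((underIncl P).obj τ))
  have hn := η.naturality ((underIncl P).map f)
  refine hn.trans ?_
  rw [← he, ← he, ← CategoryTheory.Functor.map_comp, Category.assoc, Category.assoc, eqToHom_trans,
    eqToHom_refl, Category.comp_id, CategoryTheory.Functor.map_comp]
  rfl

/-- If `φ` is not an isomorphism, then neither is its image under the retraction. -/
theorem isIso_of_isRetractionAt {p : ℕ} [Fact p.Prime] (hS : IsDiscretePToral p S) {φ : Under P}
    {ρ : NormUnder P} {η : (underIncl P).obj ρ ⟶ φ} (h : IsRetractionAt I c φ ρ η)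
    [IsIso ((underIncl P).obj ρ).hom] : IsIso φ.hom := by
  have h1 : ρ.right.grp = P.grp := by
    rw [← im_underIncl_hom ρ, im_of_isIso]
    exact (NormObj.prod_grp (le_right_grp ρ)).symm
  rw [h.1, ← c.image_eq φ] at h1
  have h2 : (normInObj φ.hom).grp = (imageObj φ.hom).grp :=
    imageOn_injective (proj_injective _) inf_le_left (le_normS _) h1
  exact isIso_of_im_eq φ.hom (hS.eq_of_normalizer_inf_le (imageObj_le φ.hom) h2.le)

end CentricLinkingSystem

theorem CategoryTheory.ObjectProperty.functor_ext_of_comp_ι {C D : Type*} [Category* C]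
    [Category* D] {W : ObjectProperty D} {G H : C ⥤ W.FullSubcategory} (h : G ⋙ W.ι = H ⋙ W.ι) : G = H := by
  have hobj (X : C) : G.obj X = H.obj X := by
    have := Functor.congr_obj h X
    exact ObjectProperty.FullSubcategory.ext this
  refine CategoryTheory.Functor.ext hobj fun X Y f => ?_
  apply W.ι.map_injective
  have := Functor.congr_hom h f
  simp only [CategoryTheory.Functor.comp_map] at this
  rw [this, CategoryTheory.Functor.map_comp, CategoryTheory.Functor.map_comp, eqToHom_map,
    eqToHom_map]

open CentricLinkingSystem
theorem proposition3p1 {p : ℕ} [Fact p.Prime] {S : Type u} [Group S]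
    (hS : IsDiscretePToral p S) (F : FusionSystem S) (hF : F.IsSaturated p)
    (L : CentricLinkingSystem.{u, w} F) (P : L.Obj) (hP : F.IsFullyNormalized p P.grp) :
    Nonempty L.Inclusions ∧ Nonempty (RetractionChoice P) ∧
    ∀ (I : L.Inclusions) (c : RetractionChoice P),
      ∃ (r : Under P ⥤ NormUnder P) (η : r ⋙ underIncl P ⟶ 𝟭 (Under P)),
        (∀ φ : Under P, IsRetractionAt I c φ (r.obj φ) (η.app φ)) ∧
        underIncl P ⋙ r = 𝟭 (NormUnder P) ∧
        IsNerveEquivWithInverse r (underIncl P) ∧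
        ∃ hr : ∀ φ, nonIso P φ → normNonIso P (r.obj φ),
          underInclNonIso P ⋙ restrictNonIso r hr = 𝟭 (NormUnderNonIso P) ∧
          (∃ η' : restrictNonIso r hr ⋙ underInclNonIso P ⟶ 𝟭 (UnderNonIso P),
            ∀ φ : UnderNonIso P, (η'.app φ).hom = η.app φ.obj) ∧
          IsNerveEquivWithInverse (restrictNonIso r hr) (underInclNonIso P) := by
  refine ⟨nonempty_inclusions P, nonempty_retractionChoice hF hS.isPGroup hP, fun I c => ?_⟩
  obtain ⟨r, η, h⟩ := exists_retraction I c
  have hir := underIncl_comp_retraction h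
  have hr : ∀ φ, nonIso P φ → normNonIso P (r.obj φ) :=
    fun φ hφ hi =>
      have : IsIso ((underIncl P).obj (r.obj φ)).hom := hi
      hφ (isIso_of_isRetractionAt hS (h φ))
  have hir' : underInclNonIso P ⋙ restrictNonIso r hr = 𝟭 (NormUnderNonIso P) :=
    ObjectProperty.functor_ext_of_comp_ι
      (congrArg (fun G => (normNonIso P).ι ⋙ G) hir)
  let η' : restrictNonIso r hr ⋙ underInclNonIso P ⟶ 𝟭 (UnderNonIso P) :=
    { app := fun φ => ObjectProperty.homMk (η.app φ.obj)
      naturality := fun φ ψ f => ObjectProperty.hom_ext _ (η.naturality f.hom) }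
  exact ⟨r, η, h, hir, isNerveEquivWithInverse_of_retraction η hir, hr, hir', ⟨η', fun _ => rfl⟩,
    isNerveEquivWithInverse_of_retraction η' hir'⟩
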